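/- Let $\omega_1,\omega_2\in\mathbb{C}$ be linearly independent over $\mathbb{R}$, let $\Lambda=\mathbb{Z}\omega_1+\mathbb{Z}\omega_2$, let $T=\mathbb{C}/\Lambda$ be the associated flat torus with area $|T|$, and let $$\wp(z)=\frac{1}{z^2}+\sum_{\ell\in\Lambda\setminus\{0\}}\left(\frac{1}{(z-\ell)^2}-\frac{1}{\ell^2}\right)$$ be its Weierstrass function. Let $G$ be the Green function of $T$ with pole at $0$, that is, the integrable function $G:T\to\mathbb{R}$, continuous on $T\setminus\{0\}$, which satisfies $\int_T G\,dA=0$ and $$-\Delta G=\delta_0-\frac{1}{|T|}$$ in the sense of distributions on $T$ (such a function exists, and it is unique away from $0$). Let $z_0$ and $z_1$ be two half-period points of $T$, that is, two elements of $\left\{\tfrac{\omega_1}{2},\tfrac{\omega_2}{2},\tfrac{\omega_1+\omega_2}{2}\right\}$ modulo $\Lambda$. Then $$G(z_0)\ge G(z_1)\quad\text{if and only if}\quad |\wp(z_0)|\ge|\wp(z_1)|.$$ -/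

import Mathlib

namespace PeriodPair

/-- The half-open fundamental parallelogram of the flat torus `T = ℂ / (ℤ ω₁ + ℤ ω₂)`.
Functions on `T` are represented by functions on `ℂ` that are periodic under the lattice, and
`∫_T` is the Lebesgue integral over this parallelogram. -/
def cell (L : PeriodPair) : Set ℂ := ZSpan.fundamentalDomain L.basis

/-- The area `|T|` of the flat torus. -/
noncomputable def area (L : PeriodPair) : ℝ := MeasureTheory.volume.real L.cell

/-- `f`, a function on `ℂ`, is invariant under translation by the lattice, i.e. it is a function
on the torus. -/
def IsPeriodic (L : PeriodPair) (f : ℂ → ℝ) : Prop :=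
  ∀ l ∈ L.lattice, ∀ z, f (z + l) = f z

/-- `G` is the Green function `G(z) = G(z, 0)` of the flat torus `T`: an integrable function on `T`,
continuous away from the point `0 ∈ T`, with `∫_T G dA = 0` and `-ΔG = δ₀ - 1/|T|` in the sense of
distributions on `T`. (Continuity away from `0` selects the representative whose point values
are meant; the value at the singular point `0` itself is irrelevant.) -/
structure IsGreenFunction (L : PeriodPair) (G : ℂ → ℝ) : Prop where
  periodic : L.IsPeriodic G
  continuousOn : ContinuousOn G ((L.lattice : Set ℂ)ᶜ)
  integrableOn : MeasureTheory.IntegrableOn G L.cell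
  integral_eq_zero : ∫ z in L.cell, G z = 0
  neg_laplacian_eq : ∀ φ : ℂ → ℝ, ContDiff ℝ (⊤ : ℕ∞) φ → L.IsPeriodic φ →
    ∫ z in L.cell, G z * -(Laplacian.laplacian φ z : ℝ) =
      φ 0 - L.area⁻¹ * ∫ z in L.cell, φ z

/-- `z` represents one of the three half period points `ω₁/2`, `ω₂/2`, `ω₃/2 = (ω₁ + ω₂)/2`
of the torus. -/
def IsHalfPeriodPoint (L : PeriodPair) (z : ℂ) : Prop :=
  ∃ l ∈ L.lattice, z = L.ω₁ / 2 + l ∨ z = L.ω₂ / 2 + l ∨ z = (L.ω₁ + L.ω₂) / 2 + l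

end PeriodPair

/-!
The key is a formula for the difference of the values of the Green function at two half periods.
If `a` is a half period, then `℘ - ℘(a)` has a double pole at the lattice points and, as `℘'`
vanishes at `a`, a double zero at `a`. By counting degrees it has no further zeros, so
`log |℘ - ℘(a)|` and `4π (G(z) - G(z - a))` have the same distributional Laplacian on the torus and
differ by a constant (`PeriodPair.exists_log_norm_weierstrassP_sub_eq`). For half periods `a` and `b`
whose difference is not in the lattice, `c = a - b` is the third one, and the translation by `-c`
exchanges `a` and `b` modulo the lattice. Evaluating the formula for `c` at `a` and at `b` gives
`log |℘(a) - ℘(c)| - log |℘(b) - ℘(c)| = 8π (G(a) - G(b))`. The three values of `℘` are distinct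
roots of `4 X³ - g₂ X - g₃`, so they sum to zero, and the left-hand side compares `|2 ℘(a) + ℘(b)|`
with `|2 ℘(b) + ℘(a)|`, which is the same as comparing `|℘(a)|` with `|℘(b)|`
(`PeriodPair.green_le_green_iff`).

Existence of the Green function comes from a theta function: `|θ(z)|` times the exponential of a
quadratic function of `Im (z / ω₁)` is periodic, and `θ` has simple zeros, at the lattice points only.
The zeros of `θ` and of `℘ - ℘(a)` are both found by the same argument
(`PeriodPair.untop₀_meromorphicOrderAt_eq`): the distributional Laplacian of `log |f|` is `2π` times
the divisor of `f` (`integral_log_norm_mul_laplacian_eq_finsum`), and testing it against a function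
whose lattice translates sum to one yields the degree of the divisor on the torus.

Uniqueness, and every statement that two functions differ by a constant, rests on Weyl's lemma for
the torus (`PeriodPair.ae_eq_const_of_harmonic`). It is proved without elliptic regularity theory:
convolution with the Green function that has been constructed solves the Poisson equation for smooth
right-hand sides, so a distributionally harmonic function is orthogonal to all smooth functions of
mean zero.
-/

open MeasureTheory Set Filter Topology Metric Complex
open scoped Real ContDiff InnerProductSpace

/-! ### Calculus of the Laplacian on the plane -/

/-- The Laplacian as `∂ₓ² + ∂ᵧ²`, with iterated first derivatives. -/
theorem laplacian_eq_fderiv_fderiv {f : ℂ → ℝ} (hf : ContDiff ℝ 2 f) (z : ℂ) :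
    (Laplacian.laplacian f : ℂ → ℝ) z =
      fderiv ℝ (fun w => fderiv ℝ f w 1) z 1 + fderiv ℝ (fun w => fderiv ℝ f w I) z I := by
  have hd : DifferentiableAt ℝ (fderiv ℝ f) z :=
    ((hf.fderiv_right (m := 1) (by norm_num)).differentiable (by norm_num)) z
  rw [InnerProductSpace.laplacian_eq_iteratedFDeriv_complexPlane]
  simp only [iteratedFDeriv_two_apply]
  rw [fderiv_clm_apply hd (by fun_prop), fderiv_clm_apply hd (by fun_prop)]
  simp

theorem ContDiff.laplacian {f : ℂ → ℝ} (hf : ContDiff ℝ ∞ f) :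
    ContDiff ℝ ∞ (Laplacian.laplacian f : ℂ → ℝ) := by
  have h : (Laplacian.laplacian f : ℂ → ℝ) = fun z =>
      fderiv ℝ (fun w => fderiv ℝ f w 1) z 1 + fderiv ℝ (fun w => fderiv ℝ f w I) z I :=
    funext (laplacian_eq_fderiv_fderiv (hf.of_le (by norm_cast)))
  rw [h]
  have h1 : ∀ v : ℂ, ∀ g : ℂ → ℝ, ContDiff ℝ ∞ g → ContDiff ℝ ∞ (fun w => fderiv ℝ g w v) :=
    fun v g hg => (hg.fderiv_right (m := ∞) (by simp)).clm_apply contDiff_const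
  exact (h1 _ _ (h1 _ _ hf)).add (h1 _ _ (h1 _ _ hf))

theorem laplacian_eq_zero_of_notMem_tsupport {f : ℂ → ℝ} {z : ℂ} (hz : z ∉ tsupport f) :
    (Laplacian.laplacian f : ℂ → ℝ) z = 0 := by
  have h := (notMem_tsupport_iff_eventuallyEq.mp hz)
  rw [(InnerProductSpace.laplacian_congr_nhds h).eq_of_nhds]
  exact congrFun (InnerProductSpace.laplacian_const (E := ℂ) (c := (0 : ℝ))) z

theorem HasCompactSupport.laplacian {f : ℂ → ℝ} (hf : HasCompactSupport f) :
    HasCompactSupport (Laplacian.laplacian f : ℂ → ℝ) :=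
  HasCompactSupport.intro hf fun _ => laplacian_eq_zero_of_notMem_tsupport

theorem laplacian_comp_add_right (f : ℂ → ℝ) (a z : ℂ) :
    (Laplacian.laplacian (fun w => f (w + a)) : ℂ → ℝ) z =
      (Laplacian.laplacian f : ℂ → ℝ) (z + a) := by
  simp [InnerProductSpace.laplacian_eq_iteratedFDeriv_complexPlane, iteratedFDeriv_comp_add_right]

theorem fderiv_comp_const_sub_apply {f : ℂ → ℝ} (hf : Differentiable ℝ f) (a z v : ℂ) :
    fderiv ℝ (fun w => f (a - w)) z v = -fderiv ℝ f (a - z) v := by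
  have h : HasFDerivAt (fun w => f (a - w)) ((fderiv ℝ f (a - z)).comp (-.id ℝ ℂ)) z :=
    (hf (a - z)).hasFDerivAt.comp z ((hasFDerivAt_id z).const_sub a)
  rw [h.fderiv]
  simp

theorem laplacian_comp_const_sub {f : ℂ → ℝ} (hf : ContDiff ℝ 2 f) (a z : ℂ) :
    (Laplacian.laplacian (fun w => f (a - w)) : ℂ → ℝ) z =
      (Laplacian.laplacian f : ℂ → ℝ) (a - z) := by
  have hd : Differentiable ℝ f := hf.differentiable (by norm_num)
  have h1 : ∀ v : ℂ, fderiv ℝ (fun w => fderiv ℝ (fun w => f (a - w)) w v) z v =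
      fderiv ℝ (fun w => fderiv ℝ f w v) (a - z) v := by
    intro v
    have hd2 : Differentiable ℝ (fun w => fderiv ℝ f w v) :=
      ((hf.fderiv_right (m := 1) (by norm_num)).clm_apply contDiff_const).differentiable
        (by norm_num)
    simp only [fderiv_comp_const_sub_apply hd]
    rw [fderiv_fun_neg]
    simp [fderiv_comp_const_sub_apply hd2]
  have hf' : ContDiff ℝ 2 (fun w => f (a - w)) := hf.comp (contDiff_const.sub contDiff_id)
  rw [laplacian_eq_fderiv_fderiv hf', laplacian_eq_fderiv_fderiv hf, h1, h1]

/-- Green's second identity against a test function, for a function that is smooth near the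
support of the test function. -/
theorem integral_mul_laplacian {u ψ : ℂ → ℝ} {R : ℝ} (hR : 0 < R)
    (hu : ∀ z ∈ closedBall (0 : ℂ) (R + 1), ContDiffAt ℝ ∞ u z)
    (hψ : ContDiff ℝ ∞ ψ) (hs : tsupport ψ ⊆ ball 0 R) :
    ∫ z, u z * (Laplacian.laplacian ψ : ℂ → ℝ) z =
      ∫ z, (Laplacian.laplacian u : ℂ → ℝ) z * ψ z := by
  have hc : HasCompactSupport ψ :=
    HasCompactSupport.of_support_subset_isCompact (isCompact_closedBall (0 : ℂ) R)
      ((subset_tsupport ψ).trans (hs.trans ball_subset_closedBall))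
  -- The cutoff `η` equals `1` near the support of `ψ` and makes `u` a Schwartz function.
  let η : ContDiffBump (0 : ℂ) := ⟨R, R + 1, hR, by linarith⟩
  have hv : ContDiff ℝ ∞ (fun z => η z * u z) := by
    rw [contDiff_iff_contDiffAt]
    intro z
    by_cases hz : z ∈ closedBall (0 : ℂ) (R + 1)
    · exact η.contDiff.contDiffAt.mul (hu z hz)
    · have : (fun z => η z * u z) =ᶠ[𝓝 z] fun _ => 0 := by
        filter_upwards [isClosed_closedBall.isOpen_compl.mem_nhds hz] with w hw
        have hw' : R + 1 ≤ dist w 0 := (not_le.mp fun h => hw (mem_closedBall.mpr h)).le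
        rw [η.zero_of_le_dist hw', zero_mul]
      exact contDiffAt_const.congr_of_eventuallyEq this
  have hvc : HasCompactSupport (fun z => η z * u z) := η.hasCompactSupport.mul_right
  have hloc : ∀ z ∈ ball (0 : ℂ) R, (fun z => η z * u z) =ᶠ[𝓝 z] u := by
    intro z hz
    filter_upwards [isOpen_ball.mem_nhds hz] with w hw
    rw [η.one_of_mem_closedBall (ball_subset_closedBall hw), one_mul]
  have key := SchwartzMap.integral_mul_laplacian_right_eq_left (μ := volume) (𝕜 := ℝ)
    (hvc.toSchwartzMap hv) (hc.toSchwartzMap hψ)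
  simp only [SchwartzMap.laplacian_apply] at key
  have e1 : ⇑(hvc.toSchwartzMap hv) = fun z => η z * u z := rfl
  have e2 : ⇑(hc.toSchwartzMap hψ) = ψ := rfl
  rw [e1, e2] at key
  calc _ = ∫ z, (η z * u z) * (Laplacian.laplacian ψ : ℂ → ℝ) z := by
        congr 1 with z
        by_cases hz : z ∈ tsupport ψ
        · rw [(hloc z (hs hz)).eq_of_nhds]
        · rw [laplacian_eq_zero_of_notMem_tsupport hz]; simp
    _ = _ := key
    _ = _ := by
        congr 1 with z
        by_cases hz : z ∈ tsupport ψ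
        · rw [(InnerProductSpace.laplacian_congr_nhds (hloc z (hs hz))).eq_of_nhds]
        · rw [image_eq_zero_of_notMem_tsupport hz]; simp

/-! ### The fundamental solution of the Laplacian -/

/-- The logarithm is dominated by `(1 + R ^ 2) / ‖z‖`, which is integrable in two dimensions. -/
theorem integrableOn_log_norm_ball (R : ℝ) :
    IntegrableOn (fun z : ℂ => Real.log ‖z‖) (ball 0 R) := by
  refine integrableOn_ball_of_norm_le_rpow (C := 1 + R ^ 2) (α := 1) (by simp) (by simp) ?_
    (by measurability : Measurable fun z : ℂ => Real.log ‖z‖).aestronglyMeasurable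
  refine (ae_restrict_iff' measurableSet_ball).mpr (.of_forall fun z hz => ?_)
  rw [mem_ball_zero_iff] at hz
  rcases (norm_nonneg z).eq_or_lt with h0 | h0
  · simp [← h0, Real.zero_rpow]
  rw [Real.rpow_neg_one, ← div_eq_mul_inv, le_div_iff₀ h0, Real.norm_eq_abs]
  rcases le_total 1 ‖z‖ with h1 | h1
  · rw [abs_of_nonneg (Real.log_nonneg h1)]
    nlinarith [Real.log_le_sub_one_of_pos h0]
  · rw [abs_of_nonpos (Real.log_nonpos h0.le h1)]
    have := Real.log_le_sub_one_of_pos (inv_pos.mpr h0)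
    rw [Real.log_inv] at this
    have h2 : ‖z‖⁻¹ * ‖z‖ = 1 := inv_mul_cancel₀ h0.ne'
    nlinarith [mul_le_mul_of_nonneg_right this h0.le]

theorem locallyIntegrable_log_norm_sub (a : ℂ) :
    LocallyIntegrable fun z : ℂ => Real.log ‖z - a‖ := by
  rw [locallyIntegrable_iff]
  intro K hK
  obtain ⟨R, hR⟩ := hK.isBounded.subset_ball a
  refine IntegrableOn.mono_set ?_ hR
  have h := (integrableOn_log_norm_ball R)
  have h2 := (measurePreserving_sub_right (volume : Measure ℂ) a).integrableOn_comp_preimage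
    (MeasurableEquiv.subRight a).measurableEmbedding |>.mpr h
  have h3 : (fun z : ℂ => z - a) ⁻¹' ball 0 R = ball a R := by
    ext z; simp [dist_eq_norm]
  rwa [h3] at h2

/-- The rescaled Laplacian of the regularized logarithm has total mass `2π`. -/
theorem integral_two_div_one_add_norm_sq_sq :
    Integrable (fun w : ℂ => 2 / (1 + ‖w‖ ^ 2) ^ 2) ∧
      ∫ w : ℂ, 2 / (1 + ‖w‖ ^ 2) ^ 2 = 2 * π := by
  have hd : ∀ x ∈ Ici (0 : ℝ), HasDerivAt (fun r : ℝ => -(1 + r ^ 2)⁻¹)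
      (x ^ 1 • (2 / (1 + x ^ 2) ^ 2)) x := by
    intro x _
    have hx : (1 + x ^ 2 : ℝ) ≠ 0 := by positivity
    have h : HasDerivAt (fun r : ℝ => 1 + r ^ 2) (2 * x) x := by
      simpa using (hasDerivAt_pow 2 x).const_add 1
    refine (h.inv hx).neg.congr_deriv ?_
    simp only [smul_eq_mul]
    field_simp
  have hlim : Tendsto (fun r : ℝ => -(1 + r ^ 2)⁻¹) atTop (𝓝 0) := by
    have : Tendsto (fun r : ℝ => (1 + r ^ 2)⁻¹) atTop (𝓝 0) :=
      (tendsto_atTop_add_const_left _ _ (tendsto_pow_atTop (by norm_num))).inv_tendsto_atTop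
    simpa using this.neg
  have hnn : ∀ x ∈ Ioi (0 : ℝ), 0 ≤ x ^ 1 • (2 / (1 + x ^ 2) ^ 2) := fun x hx => by
    have : 0 < x := hx
    simp only [smul_eq_mul]; positivity
  have hint := integrableOn_Ioi_deriv_of_nonneg' hd hnn hlim
  have hval := integral_Ioi_of_hasDerivAt_of_nonneg' hd hnn hlim
  constructor
  · have := integrable_fun_norm_addHaar (E := ℂ) volume (f := fun r : ℝ => 2 / (1 + r ^ 2) ^ 2)
    simp only [finrank_real_complex] at this
    exact this.mpr hint
  · have := integral_fun_norm_addHaar (E := ℂ) volume (fun r : ℝ => 2 / (1 + r ^ 2) ^ 2)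
    simp only [finrank_real_complex] at this
    rw [this, hval]
    simp [measureReal_def]

theorem hasFDerivAt_log_norm_sq_add {ε : ℝ} (hε : 0 < ε) (w : ℂ) :
    HasFDerivAt (fun z : ℂ => Real.log (‖z‖ ^ 2 + ε ^ 2) / 2)
      ((‖w‖ ^ 2 + ε ^ 2)⁻¹ • (w.re • reCLM + w.im • imCLM)) w := by
  have h0 : (fun z : ℂ => Real.log (‖z‖ ^ 2 + ε ^ 2) / 2) =
      fun z => Real.log (z.re * z.re + z.im * z.im + ε ^ 2) / 2 := by
    ext z; rw [Complex.sq_norm, normSq_apply]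
  have hp : w.re * w.re + w.im * w.im + ε ^ 2 ≠ 0 := by nlinarith [pow_pos hε 2]
  rw [h0, Complex.sq_norm, normSq_apply]
  have hre : HasFDerivAt Complex.re reCLM w := reCLM.hasFDerivAt
  have him : HasFDerivAt Complex.im imCLM w := imCLM.hasFDerivAt
  have := ((((hre.mul hre).add (him.mul him)).add_const (ε ^ 2)).log hp).mul_const (2⁻¹ : ℝ)
  simp only [div_eq_mul_inv]
  refine this.congr_fderiv ?_
  ext v
  simp
  ring

/-- The Laplacian of the regularization `log √(‖z‖² + ε²)` of `log ‖z‖`, an approximate identity of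
mass `2π`. -/
theorem laplacian_log_norm_sq_add {ε : ℝ} (hε : 0 < ε) (z : ℂ) :
    (Laplacian.laplacian (fun z : ℂ => Real.log (‖z‖ ^ 2 + ε ^ 2) / 2) : ℂ → ℝ) z =
      2 * ε ^ 2 / (‖z‖ ^ 2 + ε ^ 2) ^ 2 := by
  have hp : ∀ w : ℂ, ‖w‖ ^ 2 + ε ^ 2 ≠ 0 := fun w => by positivity
  have hc : ContDiff ℝ 2 (fun z : ℂ => Real.log (‖z‖ ^ 2 + ε ^ 2) / 2) :=
    (((contDiff_norm_sq ℝ).add contDiff_const).log hp).div_const _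
  rw [laplacian_eq_fderiv_fderiv hc]
  simp only [(hasFDerivAt_log_norm_sq_add hε _).fderiv]
  have hq : z.re * z.re + z.im * z.im + ε ^ 2 ≠ 0 := by nlinarith [pow_pos hε 2]
  have hre : HasFDerivAt Complex.re reCLM z := reCLM.hasFDerivAt
  have him : HasFDerivAt Complex.im imCLM z := imCLM.hasFDerivAt
  have hb := (((hre.mul hre).add (him.mul him)).add_const (ε ^ 2))
  have hb' : HasFDerivAt (fun w : ℂ => (w.re * w.re + w.im * w.im + ε ^ 2)⁻¹) _ z :=
    (hasDerivAt_inv hq).comp_hasFDerivAt z hb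
  have h1 := hb'.mul hre
  have h2 := hb'.mul him
  simp only [Complex.sq_norm, normSq_apply]
  have e1 : (fun w : ℂ => ((w.re * w.re + w.im * w.im + ε ^ 2)⁻¹ •
      (w.re • reCLM + w.im • imCLM)) 1) =
      fun w : ℂ => (w.re * w.re + w.im * w.im + ε ^ 2)⁻¹ * w.re := by ext w; simp
  have e2 : (fun w : ℂ => ((w.re * w.re + w.im * w.im + ε ^ 2)⁻¹ •
      (w.re • reCLM + w.im • imCLM)) I) =
      fun w : ℂ => (w.re * w.re + w.im * w.im + ε ^ 2)⁻¹ * w.im := by ext w; simp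
  rw [e1, e2]
  erw [h1.fderiv, h2.fderiv]
  simp
  field_simp
  ring

/-- The logarithm is `2π` times a fundamental solution of the Laplacian: the limit `ε → 0` of Green's
identity for `log √(‖z‖² + ε²)`. -/
theorem integral_log_norm_mul_laplacian {ψ : ℂ → ℝ} (hψ : ContDiff ℝ ∞ ψ)
    (hc : HasCompactSupport ψ) :
    ∫ z, Real.log ‖z‖ * (Laplacian.laplacian ψ : ℂ → ℝ) z = 2 * π * ψ 0 := by
  let ε : ℕ → ℝ := fun n => 1 / ((n : ℝ) + 1)
  have hε : ∀ n, 0 < ε n := fun n => Nat.one_div_pos_of_nat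
  have hε1 : ∀ n, ε n ≤ 1 := fun n => by
    have := hε n
    simp only [ε]
    rw [div_le_one (by positivity)]
    linarith [Nat.cast_nonneg (α := ℝ) n]
  have hε0 : Tendsto ε atTop (𝓝 0) := tendsto_one_div_add_atTop_nhds_zero_nat
  obtain ⟨R, hR0, hR⟩ : ∃ R, 0 < R ∧ tsupport ψ ⊆ ball 0 R := by
    obtain ⟨R, hR⟩ := hc.isBounded.subset_ball (0 : ℂ)
    exact ⟨max R 1, by positivity, hR.trans (ball_subset_ball (le_max_left _ _))⟩
  have hL : ContDiff ℝ ∞ (Laplacian.laplacian ψ : ℂ → ℝ) := hψ.laplacian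
  have hLc : HasCompactSupport (Laplacian.laplacian ψ : ℂ → ℝ) := hc.laplacian
  have lim1 : Tendsto (fun n => ∫ z, Real.log (‖z‖ ^ 2 + ε n ^ 2) / 2 *
      (Laplacian.laplacian ψ : ℂ → ℝ) z) atTop
      (𝓝 (∫ z, Real.log ‖z‖ * (Laplacian.laplacian ψ : ℂ → ℝ) z)) := by
    refine tendsto_integral_of_dominated_convergence
      (fun z => (|Real.log ‖z‖| + ‖z‖ ^ 2) * |(Laplacian.laplacian ψ : ℂ → ℝ) z|) ?_ ?_ ?_ ?_
    · intro n
      exact (by fun_prop : Measurable fun z : ℂ => Real.log (‖z‖ ^ 2 + ε n ^ 2) / 2)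
        |>.aestronglyMeasurable.mul hL.continuous.aestronglyMeasurable
    · have hloc : LocallyIntegrable fun z : ℂ => |Real.log ‖z‖| + ‖z‖ ^ 2 :=
        LocallyIntegrable.add ((locallyIntegrable_log_norm_sub 0).mono
          (by measurability : Measurable fun z : ℂ => |Real.log ‖z‖|).aestronglyMeasurable
          (.of_forall fun z => by simp))
          (by fun_prop : Continuous fun z : ℂ => ‖z‖ ^ 2).locallyIntegrable
      have := hloc.integrable_smul_right_of_hasCompactSupport hL.continuous.abs
        (hLc.comp_left abs_zero)
      simpa using this
    · intro n
      have h0 : ∀ᵐ z : ℂ, z ≠ 0 := by simp [ae_iff]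
      filter_upwards [h0] with z hz
      rw [norm_mul, Real.norm_eq_abs, Real.norm_eq_abs]
      gcongr
      have hz0 : 0 < ‖z‖ := norm_pos_iff.mpr hz
      have hlow : Real.log ‖z‖ ≤ Real.log (‖z‖ ^ 2 + ε n ^ 2) / 2 := by
        have : Real.log (‖z‖ ^ 2) ≤ Real.log (‖z‖ ^ 2 + ε n ^ 2) :=
          Real.log_le_log (by positivity) (by have := hε n; nlinarith)
        rw [Real.log_pow] at this
        push_cast at this
        linarith
      have hup : Real.log (‖z‖ ^ 2 + ε n ^ 2) / 2 ≤ ‖z‖ ^ 2 := by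
        have h1 := Real.log_le_sub_one_of_pos (x := ‖z‖ ^ 2 + ε n ^ 2)
          (by have := hε n; positivity)
        have h2 : ε n ^ 2 ≤ 1 := pow_le_one₀ (hε n).le (hε1 n)
        nlinarith
      rw [abs_le]
      constructor
      · nlinarith [neg_abs_le (Real.log ‖z‖)]
      · linarith [abs_nonneg (Real.log ‖z‖)]
    · have h0 : ∀ᵐ z : ℂ, z ≠ 0 := by simp [ae_iff]
      filter_upwards [h0] with z hz
      have hz0 : 0 < ‖z‖ := norm_pos_iff.mpr hz
      refine Tendsto.mul_const _ ?_
      have h1 : Tendsto (fun n => ‖z‖ ^ 2 + ε n ^ 2) atTop (𝓝 (‖z‖ ^ 2)) := by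
        simpa using (hε0.pow 2).const_add (‖z‖ ^ 2)
      have h2 := (h1.log (by positivity)).div_const 2
      rw [Real.log_pow] at h2
      convert h2 using 2
      push_cast
      ring
  have eq1 : ∀ n, ∫ z, Real.log (‖z‖ ^ 2 + ε n ^ 2) / 2 * (Laplacian.laplacian ψ : ℂ → ℝ) z =
      ∫ w : ℂ, 2 / (1 + ‖w‖ ^ 2) ^ 2 * ψ (ε n • w) := by
    intro n
    have hn := hε n
    rw [integral_mul_laplacian hR0 _ hψ hR]
    · have := Measure.integral_comp_smul (volume : Measure ℂ) (fun z =>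
        2 * ε n ^ 2 / (‖z‖ ^ 2 + ε n ^ 2) ^ 2 * ψ z) (ε n)
      simp only [finrank_real_complex] at this
      simp only [laplacian_log_norm_sq_add hn]
      rw [abs_of_pos (by positivity)] at this
      have h2 : ∫ z : ℂ, 2 * ε n ^ 2 / (‖z‖ ^ 2 + ε n ^ 2) ^ 2 * ψ z =
          ε n ^ 2 * ∫ w : ℂ, 2 * ε n ^ 2 / (‖ε n • w‖ ^ 2 + ε n ^ 2) ^ 2 * ψ (ε n • w) := by
        rw [this, smul_eq_mul, ← mul_assoc, mul_inv_cancel₀ (by positivity), one_mul]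
      rw [h2, ← integral_const_mul]
      congr 1 with w
      rw [norm_smul, Real.norm_of_nonneg hn.le]
      field_simp
      ring
    · intro z _
      exact ((((contDiff_norm_sq ℝ).add contDiff_const).log
        (fun w => by positivity)).div_const _).contDiffAt
  obtain ⟨hi, hv⟩ := integral_two_div_one_add_norm_sq_sq
  obtain ⟨M, hM⟩ := hψ.continuous.bounded_above_of_compact_support hc
  have lim2 : Tendsto (fun n => ∫ w : ℂ, 2 / (1 + ‖w‖ ^ 2) ^ 2 * ψ (ε n • w)) atTop
      (𝓝 (∫ w : ℂ, 2 / (1 + ‖w‖ ^ 2) ^ 2 * ψ 0)) := by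
    refine tendsto_integral_of_dominated_convergence (fun w => 2 / (1 + ‖w‖ ^ 2) ^ 2 * M) ?_
      (hi.mul_const M) ?_ ?_
    · intro n
      exact hi.1.mul (hψ.continuous.comp (continuous_const_smul _)).aestronglyMeasurable
    · intro n
      refine .of_forall fun w => ?_
      rw [norm_mul, Real.norm_of_nonneg (by positivity)]
      gcongr
      exact hM _
    · refine .of_forall fun w => Tendsto.const_mul _ ?_
      have : Tendsto (fun n => ε n • w) atTop (𝓝 0) := by simpa using hε0.smul_const w
      exact (hψ.continuous.tendsto 0).comp this
  rw [integral_mul_const, hv] at lim2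
  simp only [eq1] at lim1
  exact tendsto_nhds_unique lim1 lim2

/-- The Laplacian of `log ‖z - a‖` in the sense of distributions is `2π δ_a`. -/
theorem integral_log_norm_sub_mul_laplacian {ψ : ℂ → ℝ} (hψ : ContDiff ℝ ∞ ψ)
    (hc : HasCompactSupport ψ) (a : ℂ) :
    ∫ z, Real.log ‖z - a‖ * (Laplacian.laplacian ψ : ℂ → ℝ) z = 2 * π * ψ a := by
  have h := integral_log_norm_mul_laplacian (ψ := fun z => ψ (z + a))
    (hψ.comp (contDiff_id.add contDiff_const))
    (hc.comp_homeomorph (Homeomorph.addRight a))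
  simp only [laplacian_comp_add_right, zero_add] at h
  rw [← h, ← integral_add_right_eq_self _ a]
  simp

/-! ### The Poincaré–Lelong formula -/

/-- On a closed disc, `log ‖f‖` for `f` meromorphic is a finite sum of logarithmic poles plus the
logarithm of the norm of a holomorphic function without zeros. -/
theorem exists_log_norm_eq_sum_add {f : ℂ → ℂ} (hf : Meromorphic f)
    (hord : ∀ p, meromorphicOrderAt f p ≠ ⊤) (R : ℝ) :
    ∃ (S : Finset ℂ) (g : ℂ → ℂ),
      (∀ z ∈ closedBall (0 : ℂ) R, AnalyticAt ℂ g z ∧ g z ≠ 0) ∧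
      (∀ z ∈ closedBall (0 : ℂ) R, z ∉ S → (meromorphicOrderAt f z).untop₀ = 0) ∧
      ∀ᵐ z ∂(volume.restrict (closedBall (0 : ℂ) R)), Real.log ‖f z‖ =
        (∑ u ∈ S, ((meromorphicOrderAt f u).untop₀ : ℝ) * Real.log ‖z - u‖) +
          Real.log ‖g z‖ := by
  have hfU : MeromorphicOn f (closedBall (0 : ℂ) R) := fun z _ => hf z
  have hfin : (MeromorphicOn.divisor f (closedBall (0 : ℂ) R)).support.Finite :=
    (MeromorphicOn.divisor f _).finiteSupport (isCompact_closedBall 0 R)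
  obtain ⟨g, hg, hg0, he⟩ := hfU.extract_zeros_poles (fun u => hord u) hfin
  have hlog := MeromorphicOn.extract_zeros_poles_log hg0 he
  refine ⟨hfin.toFinset, g, fun z hz => ⟨hg z hz, hg0 ⟨z, hz⟩⟩, fun z hz hzS => ?_, ?_⟩
  · by_contra h
    exact hzS (by simpa only [Finite.mem_toFinset, Function.mem_support, hfU.divisor_apply hz])
  · have hae := ae_restrict_le_codiscreteWithin (μ := volume)
      (isClosed_closedBall (x := (0 : ℂ)) (ε := R)).measurableSet hlog
    filter_upwards [hae] with z hz
    rw [hz]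
    have hsub : (fun u => fun z : ℂ => (MeromorphicOn.divisor f (closedBall (0 : ℂ) R) u : ℝ) *
        Real.log ‖z - u‖).support ⊆ hfin.toFinset := by
      intro u hu
      by_contra h
      refine hu ?_
      simp only [Finite.coe_toFinset, Function.mem_support, not_not] at h
      ext z
      simp [h]
    simp only [Pi.add_apply]
    rw [finsum_eq_sum_of_support_subset _ hsub, Finset.sum_apply]
    congr 1
    refine Finset.sum_congr rfl fun u hu => ?_
    have huU : u ∈ closedBall (0 : ℂ) R :=
      (MeromorphicOn.divisor f _).supportWithinDomain (by simpa using hu)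
    rw [hfU.divisor_apply huU]

theorem contDiffAt_log_norm {g : ℂ → ℂ} {z : ℂ} (hg : AnalyticAt ℂ g z) (h0 : g z ≠ 0) :
    ContDiffAt ℝ ∞ (fun w => Real.log ‖g w‖) z :=
  (HarmonicAt.analyticAt (hg.harmonicAt_log_norm h0)).contDiffAt

theorem laplacian_log_norm_eq_zero {g : ℂ → ℂ} {z : ℂ} (hg : AnalyticAt ℂ g z) (h0 : g z ≠ 0) :
    (Laplacian.laplacian (fun w => Real.log ‖g w‖) : ℂ → ℝ) z = 0 :=
  (hg.harmonicAt_log_norm h0).2.eq_of_nhds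

theorem locallyIntegrable_log_norm {f : ℂ → ℂ} (hf : Meromorphic f)
    (hord : ∀ p, meromorphicOrderAt f p ≠ ⊤) :
    LocallyIntegrable fun z => Real.log ‖f z‖ := by
  rw [locallyIntegrable_iff]
  intro K hK
  obtain ⟨R, hR⟩ := hK.isBounded.subset_closedBall (0 : ℂ)
  refine IntegrableOn.mono_set ?_ hR
  obtain ⟨S, g, hg, -, hae⟩ := exists_log_norm_eq_sum_add hf hord R
  refine Integrable.congr (Integrable.add (integrable_finsetSum S fun u _ =>
    (((locallyIntegrable_log_norm_sub u).integrableOn_isCompact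
      (isCompact_closedBall 0 R)).const_mul _)) ?_) (hae.mono fun z hz => hz.symm)
  exact ContinuousOn.integrableOn_compact (isCompact_closedBall 0 R) fun z hz =>
    (contDiffAt_log_norm (hg z hz).1 (hg z hz).2).continuousAt.continuousWithinAt

theorem HasCompactSupport.exists_tsupport_subset_ball {ψ : ℂ → ℝ} (hc : HasCompactSupport ψ) :
    ∃ R, 0 < R ∧ tsupport ψ ⊆ ball 0 R := by
  obtain ⟨R, hR⟩ := hc.isBounded.subset_ball (0 : ℂ)
  exact ⟨max R 1, by positivity, hR.trans (ball_subset_ball (le_max_left _ _))⟩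

/-- The Poincaré–Lelong formula in the plane: the distributional Laplacian of `log ‖f‖` is `2π`
times the divisor of `f`. -/
theorem integral_log_norm_mul_laplacian_eq_finsum {f : ℂ → ℂ} (hf : Meromorphic f)
    (hord : ∀ p, meromorphicOrderAt f p ≠ ⊤) {ψ : ℂ → ℝ} (hψ : ContDiff ℝ ∞ ψ)
    (hc : HasCompactSupport ψ) :
    ∫ z, Real.log ‖f z‖ * (Laplacian.laplacian ψ : ℂ → ℝ) z =
      2 * π * ∑ᶠ p, ((meromorphicOrderAt f p).untop₀ : ℝ) * ψ p := by
  obtain ⟨R, hR0, hR⟩ := hc.exists_tsupport_subset_ball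
  obtain ⟨S, g, hg, hS, hae⟩ := exists_log_norm_eq_sum_add hf hord (R + 1)
  have hsub : ball (0 : ℂ) R ⊆ closedBall 0 (R + 1) :=
    ball_subset_closedBall.trans (closedBall_subset_closedBall (by linarith))
  have h1 : ∀ᵐ z : ℂ, Real.log ‖f z‖ * (Laplacian.laplacian ψ : ℂ → ℝ) z =
      (∑ u ∈ S, ((meromorphicOrderAt f u).untop₀ : ℝ) *
        (Real.log ‖z - u‖ * (Laplacian.laplacian ψ : ℂ → ℝ) z)) +
          Real.log ‖g z‖ * (Laplacian.laplacian ψ : ℂ → ℝ) z := by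
    rw [ae_restrict_iff' isClosed_closedBall.measurableSet] at hae
    filter_upwards [hae] with z hz
    by_cases hzs : z ∈ tsupport ψ
    · rw [hz (hsub (hR hzs)), add_mul, Finset.sum_mul]
      simp only [mul_assoc]
    · simp [laplacian_eq_zero_of_notMem_tsupport hzs]
  have hL := hψ.laplacian.continuous
  have hint : ∀ u : ℂ, Integrable fun z =>
      Real.log ‖z - u‖ * (Laplacian.laplacian ψ : ℂ → ℝ) z := fun u => by
    simpa using (locallyIntegrable_log_norm_sub u).integrable_smul_right_of_hasCompactSupport
      hL hc.laplacian
  have hgi : Integrable fun z => Real.log ‖g z‖ * (Laplacian.laplacian ψ : ℂ → ℝ) z := by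
    have hK : tsupport ψ ⊆ closedBall 0 (R + 1) := hR.trans hsub
    refine (integrableOn_iff_integrable_of_support_subset (s := tsupport ψ) fun z hz => ?_).mp
      (ContinuousOn.integrableOn_compact hc fun z hz => ?_)
    · by_contra h
      exact hz (by simp [laplacian_eq_zero_of_notMem_tsupport h])
    · exact ((contDiffAt_log_norm (hg z (hK hz)).1 (hg z (hK hz)).2).continuousAt.mul
        hL.continuousAt).continuousWithinAt
  have hg0 : ∫ z, Real.log ‖g z‖ * (Laplacian.laplacian ψ : ℂ → ℝ) z = 0 := by
    rw [integral_mul_laplacian hR0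
      (fun z hz => contDiffAt_log_norm (hg z hz).1 (hg z hz).2) hψ hR]
    refine integral_eq_zero_of_ae (.of_forall fun z => ?_)
    by_cases hzs : z ∈ tsupport ψ
    · have hz := hg z (hsub (hR hzs))
      simp [laplacian_log_norm_eq_zero hz.1 hz.2]
    · simp [image_eq_zero_of_notMem_tsupport hzs]
  rw [integral_congr_ae h1, integral_add (integrable_finsetSum S fun u _ => (hint u).const_mul _)
    hgi, hg0, add_zero, integral_finsetSum S fun u _ => (hint u).const_mul _]
  simp only [integral_const_mul, integral_log_norm_sub_mul_laplacian hψ hc]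
  rw [finsum_eq_sum_of_support_subset (s := S), Finset.mul_sum]
  · exact Finset.sum_congr rfl fun u _ => by ring
  · intro p hp
    by_contra h
    refine hp ?_
    by_cases hps : p ∈ tsupport ψ
    · simp [hS p (hsub (hR hps)) h]
    · simp [image_eq_zero_of_notMem_tsupport hps]

/-! ### Periodization of test functions -/

namespace PeriodPair

variable (L : PeriodPair)

/-- The sum of the translates of `ψ` under the period lattice. -/
noncomputable def periodize (ψ : ℂ → ℝ) (z : ℂ) : ℝ := ∑' l : L.lattice, ψ (z + l)

theorem isBounded_cell : Bornology.IsBounded L.cell := ZSpan.fundamentalDomain_isBounded L.basis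

theorem measurableSet_cell : MeasurableSet L.cell :=
  ZSpan.fundamentalDomain_measurableSet L.basis

theorem isAddFundamentalDomain_cell :
    IsAddFundamentalDomain L.lattice L.cell (volume : Measure ℂ) := by
  have h := ZSpan.isAddFundamentalDomain L.basis (volume : Measure ℂ)
  rw [← L.lattice_eq_span_range_basis] at h
  exact h

theorem exists_add_mem_cell (z : ℂ) : ∃ l ∈ L.lattice, z + l ∈ L.cell := by
  obtain ⟨v, hv, -⟩ := ZSpan.exist_unique_vadd_mem_fundamentalDomain L.basis z
  refine ⟨v, ?_, ?_⟩
  · rw [L.lattice_eq_span_range_basis]; exact v.2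
  · rw [add_comm]; exact hv

theorem finite_setOf_norm_le (R : ℝ) : {l : L.lattice | ‖(l : ℂ)‖ ≤ R}.Finite := by
  refine (isCompact_iff_finite.mp (isCompact_closedBall (0 : L.lattice) R)).subset ?_
  intro l hl
  simpa using hl

/-- Near a bounded set the periodization of a compactly supported function is a finite sum. -/
theorem exists_finset_periodize_eq {ψ : ℂ → ℝ} (hc : HasCompactSupport ψ) (R : ℝ) :
    ∃ S : Finset L.lattice, ∀ z, ‖z‖ ≤ R → ∀ l ∉ S, ψ (z + l) = 0 := by
  obtain ⟨M, hM⟩ := hc.isBounded.exists_norm_le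
  refine ⟨(L.finite_setOf_norm_le (M + R)).toFinset, fun z hz l hl => ?_⟩
  by_contra h
  refine hl ?_
  have h1 : ‖z + l‖ ≤ M := hM _ (subset_tsupport ψ h)
  have h2 : ‖(l : ℂ)‖ ≤ ‖z + l‖ + ‖z‖ := by
    simpa using norm_sub_le (z + l : ℂ) z
  simp only [Finite.mem_toFinset, mem_ofPred_eq]
  linarith

theorem periodize_eventuallyEq {ψ : ℂ → ℝ} (hc : HasCompactSupport ψ) (z₀ : ℂ) :
    ∃ S : Finset L.lattice, (∀ l ∉ S, ψ (z₀ + l) = 0) ∧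
      L.periodize ψ =ᶠ[𝓝 z₀] fun z => ∑ l ∈ S, ψ (z + l) := by
  obtain ⟨S, hS⟩ := L.exists_finset_periodize_eq hc (‖z₀‖ + 1)
  refine ⟨S, hS z₀ (by linarith), ?_⟩
  filter_upwards [ball_mem_nhds z₀ one_pos] with z hz
  refine tsum_eq_sum fun l hl => hS z ?_ l hl
  have := norm_sub_norm_le z z₀
  rw [mem_ball, dist_eq_norm] at hz
  linarith

theorem summable_periodize {ψ : ℂ → ℝ} (hc : HasCompactSupport ψ) (z : ℂ) :
    Summable fun l : L.lattice => ψ (z + l) := by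
  obtain ⟨S, hS, -⟩ := L.periodize_eventuallyEq hc z
  exact summable_of_ne_finset_zero hS

theorem isPeriodic_periodize (ψ : ℂ → ℝ) : L.IsPeriodic (L.periodize ψ) := by
  intro l hl z
  rw [periodize, periodize, ← (Equiv.addLeft (⟨l, hl⟩ : L.lattice)).tsum_eq (fun m => ψ (z + m))]
  simp [add_assoc]

theorem contDiff_periodize {ψ : ℂ → ℝ} (hψ : ContDiff ℝ ∞ ψ) (hc : HasCompactSupport ψ) :
    ContDiff ℝ ∞ (L.periodize ψ) := by
  rw [contDiff_iff_contDiffAt]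
  intro z
  obtain ⟨S, -, hS⟩ := L.periodize_eventuallyEq hc z
  refine ContDiffAt.congr_of_eventuallyEq ?_ hS
  exact (ContDiff.sum fun l _ => hψ.comp (contDiff_id.add contDiff_const)).contDiffAt

theorem laplacian_sum {ι : Type*} (S : Finset ι) {f : ι → ℂ → ℝ}
    (hf : ∀ i ∈ S, ContDiff ℝ ∞ (f i)) (z : ℂ) :
    (Laplacian.laplacian (fun w => ∑ i ∈ S, f i w) : ℂ → ℝ) z =
      ∑ i ∈ S, (Laplacian.laplacian (f i) : ℂ → ℝ) z := by
  classical
  induction S using Finset.induction_on with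
  | empty => simp
  | insert i S hi ih =>
    have h2 : (2 : WithTop ℕ∞) ≤ ∞ := by norm_cast
    rw [Finset.sum_insert hi, ← ih fun j hj => hf j (Finset.mem_insert_of_mem hj),
      ← ContDiffAt.laplacian_add ((hf i (Finset.mem_insert_self _ _)).of_le h2).contDiffAt
        ((ContDiff.sum fun j hj => hf j (Finset.mem_insert_of_mem hj)).of_le h2).contDiffAt]
    have he : (fun w => ∑ j ∈ insert i S, f j w) = f i + fun w => ∑ j ∈ S, f j w := by
      ext w; simp [Finset.sum_insert hi]
    rw [he]

theorem laplacian_periodize {ψ : ℂ → ℝ} (hψ : ContDiff ℝ ∞ ψ) (hc : HasCompactSupport ψ) (z : ℂ) :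
    (Laplacian.laplacian (L.periodize ψ) : ℂ → ℝ) z =
      L.periodize (Laplacian.laplacian ψ) z := by
  obtain ⟨S, hS⟩ := L.exists_finset_periodize_eq hc (‖z‖ + 1)
  have hball : ∀ w ∈ ball z 1, ∀ l ∉ S, ψ (w + l) = 0 := fun w hw l hl => by
    refine hS w ?_ l hl
    have := norm_sub_norm_le w z
    rw [mem_ball, dist_eq_norm] at hw
    linarith
  have h1 : L.periodize ψ =ᶠ[𝓝 z] fun w => ∑ l ∈ S, ψ (w + l) := by
    filter_upwards [ball_mem_nhds z one_pos] with w hw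
    exact tsum_eq_sum (hball w hw)
  have htr : ∀ l : L.lattice, ContDiff ℝ ∞ fun w => ψ (w + l) := fun l =>
    hψ.comp (contDiff_id.add contDiff_const)
  have h2 : ∀ l ∉ S, (Laplacian.laplacian ψ : ℂ → ℝ) (z + l) = 0 := fun l hl => by
    have : (fun w => ψ (w + l)) =ᶠ[𝓝 z] fun _ => 0 := by
      filter_upwards [ball_mem_nhds z one_pos] with w hw using hball w hw l hl
    rw [← laplacian_comp_add_right, (InnerProductSpace.laplacian_congr_nhds this).eq_of_nhds]
    simp
  rw [(InnerProductSpace.laplacian_congr_nhds h1).eq_of_nhds, laplacian_sum S fun l _ => htr l,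
    periodize, tsum_eq_sum h2]
  simp only [laplacian_comp_add_right]

/-- A function on the torus that is integrable on the fundamental cell is locally integrable on the
plane. -/
theorem IsPeriodic.locallyIntegrable {u : ℂ → ℝ} (hu : L.IsPeriodic u)
    (hi : IntegrableOn u L.cell) : LocallyIntegrable u := by
  rw [locallyIntegrable_iff]
  intro K hK
  obtain ⟨R, hR⟩ := hK.isBounded.exists_norm_le
  obtain ⟨M, hM⟩ := L.isBounded_cell.exists_norm_le
  have hsub : K ⊆ ⋃ l ∈ {l : L.lattice | ‖(l : ℂ)‖ ≤ M + R}, (fun z => z + (l : ℂ)) ⁻¹' L.cell := by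
    intro z hz
    obtain ⟨l, hl, hzl⟩ := L.exists_add_mem_cell z
    refine mem_biUnion (x := (⟨l, hl⟩ : L.lattice)) ?_ hzl
    have h1 := hM _ hzl
    have h2 := hR _ hz
    have h3 : ‖l‖ ≤ ‖z + l‖ + ‖z‖ := by simpa using norm_sub_le (z + l) z
    simp only [mem_ofPred_eq]
    linarith
  refine IntegrableOn.mono_set ?_ hsub
  rw [integrableOn_finite_biUnion (L.finite_setOf_norm_le _)]
  intro l _
  have h := (measurePreserving_add_right (volume : Measure ℂ) (l : ℂ)).integrableOn_comp_preimage
    (MeasurableEquiv.addRight (l : ℂ)).measurableEmbedding |>.mpr hi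
  refine h.congr_fun (fun z _ => ?_) (measurableSet_preimage (measurable_add_const _)
    L.measurableSet_cell)
  exact hu l l.2 z

/-- Unfolding: integrating a function on the torus against a test function on the plane. -/
theorem integral_mul_eq_integral_cell_mul_periodize {u ψ : ℂ → ℝ} (hu : L.IsPeriodic u)
    (hi : LocallyIntegrable u) (hψ : Continuous ψ) (hc : HasCompactSupport ψ) :
    ∫ z, u z * ψ z = ∫ z in L.cell, u z * L.periodize ψ z := by
  have hint : Integrable fun z => u z * ψ z := by
    simpa using hi.integrable_smul_right_of_hasCompactSupport hψ hc
  obtain ⟨M, hM⟩ := L.isBounded_cell.exists_norm_le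
  obtain ⟨S, hS⟩ := L.exists_finset_periodize_eq hc M
  have hterm : ∀ l : L.lattice, ∫ z in L.cell, u (l +ᵥ z) * ψ (l +ᵥ z) =
      ∫ z in L.cell, u z * ψ (z + l) := by
    intro l
    congr 1 with z
    have : l +ᵥ z = z + l := add_comm _ _
    rw [this, hu l l.2]
  have : VAddInvariantMeasure L.lattice ℂ volume :=
    inferInstanceAs (VAddInvariantMeasure L.lattice.toAddSubgroup ℂ volume)
  rw [L.isAddFundamentalDomain_cell.integral_eq_tsum'' _ hint]
  simp only [hterm]
  rw [tsum_eq_sum (s := S), ← integral_finsetSum]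
  · refine setIntegral_congr_fun L.measurableSet_cell fun z hz => ?_
    simp only [periodize, tsum_eq_sum (hS z (hM z hz)), Finset.mul_sum]
  · intro l _
    have : Integrable fun z => u z * ψ (z + l) := by
      simpa using hi.integrable_smul_right_of_hasCompactSupport
        (hψ.comp (continuous_id.add continuous_const))
        (hc.comp_homeomorph (Homeomorph.addRight (l : ℂ)))
    exact this.integrableOn
  · intro l hl
    refine setIntegral_eq_zero_of_forall_eq_zero fun z hz => ?_
    rw [hS z (hM z hz) l hl, mul_zero]

/-- A smooth, nonnegative, compactly supported function whose lattice translates sum to `1`. -/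
theorem exists_partition_of_unity :
    ∃ χ : ℂ → ℝ, ContDiff ℝ ∞ χ ∧ HasCompactSupport χ ∧ (∀ z, 0 ≤ χ z) ∧
      ∀ z, L.periodize χ z = 1 := by
  obtain ⟨M, hM⟩ := L.isBounded_cell.exists_norm_le
  let b : ContDiffBump (0 : ℂ) := ⟨max M 1, max M 1 + 1, by positivity, by linarith⟩
  have hb : ContDiff ℝ ∞ b := b.contDiff
  have hbc : HasCompactSupport b := b.hasCompactSupport
  have hpos : ∀ z, 0 < L.periodize b z := by
    intro z
    obtain ⟨l, hl, hz⟩ := L.exists_add_mem_cell z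
    refine (L.summable_periodize hbc z).tsum_pos (fun _ => b.nonneg) ⟨l, hl⟩ ?_
    have : b (z + l) = 1 := b.one_of_mem_closedBall (by
      simpa [b] using Or.inl (hM _ hz))
    simp [this]
  refine ⟨fun z => b z * (L.periodize b z)⁻¹, ?_, hbc.mul_right, fun z =>
    mul_nonneg b.nonneg (inv_nonneg.mpr (hpos z).le), fun z => ?_⟩
  · exact hb.mul ((L.contDiff_periodize hb hbc).inv fun z => (hpos z).ne')
  · have : ∀ l : L.lattice, L.periodize b (z + l) = L.periodize b z := fun l =>
      L.isPeriodic_periodize b l l.2 z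
    simp only [periodize] at this ⊢
    simp only [this]
    rw [tsum_mul_right]
    exact mul_inv_cancel₀ (hpos z).ne'

theorem periodize_mul {χ φ : ℂ → ℝ} (hφ : L.IsPeriodic φ) (z : ℂ) :
    L.periodize (fun w => χ w * φ w) z = L.periodize χ z * φ z := by
  simp only [periodize, hφ _ (Subtype.mem _)]
  exact tsum_mul_right

/-- Integration by parts against periodic test functions reduces to test functions on the plane. -/
theorem integral_cell_mul_laplacian {u φ χ : ℂ → ℝ} (hu : L.IsPeriodic u)
    (hi : LocallyIntegrable u) (hφ : ContDiff ℝ ∞ φ) (hφp : L.IsPeriodic φ)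
    (hχ : ContDiff ℝ ∞ χ) (hχc : HasCompactSupport χ) (hχ1 : ∀ z, L.periodize χ z = 1) :
    ∫ z in L.cell, u z * (Laplacian.laplacian φ : ℂ → ℝ) z =
      ∫ z, u z * (Laplacian.laplacian (fun w => χ w * φ w) : ℂ → ℝ) z := by
  have h1 : L.periodize (fun w => χ w * φ w) = φ := by
    ext z; rw [L.periodize_mul hφp, hχ1, one_mul]
  have hs : ContDiff ℝ ∞ fun w => χ w * φ w := hχ.mul hφ
  have hc : HasCompactSupport fun w => χ w * φ w := hχc.mul_right
  rw [L.integral_mul_eq_integral_cell_mul_periodize hu hi hs.laplacian.continuous hc.laplacian]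
  congr 1 with z
  rw [← L.laplacian_periodize hs hc, h1]

theorem integral_eq_integral_cell_periodize {ψ : ℂ → ℝ} (hψ : Continuous ψ)
    (hc : HasCompactSupport ψ) : ∫ z, ψ z = ∫ z in L.cell, L.periodize ψ z := by
  simpa using L.integral_mul_eq_integral_cell_mul_periodize (u := fun _ => 1) (fun _ _ _ => rfl)
    (locallyIntegrable_const 1) hψ hc

end PeriodPair

/-! ### Divisors of functions with periodic modulus -/

namespace PeriodPair

variable (L : PeriodPair)

open Classical in
/-- The divisor of the point `a` of the torus, as a function on the plane: the indicator function
of the coset `a + Λ`. -/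
noncomputable def cosetDivisor (a p : ℂ) : ℤ := if p - a ∈ L.lattice then 1 else 0

theorem cosetDivisor_add_of_mem (a : ℂ) {l : ℂ} (hl : l ∈ L.lattice) (p : ℂ) :
    L.cosetDivisor a (p + l) = L.cosetDivisor a p := by
  have : p + l - a ∈ L.lattice ↔ p - a ∈ L.lattice := by
    rw [add_sub_right_comm]
    exact L.lattice.add_mem_iff_left hl
  classical
  exact if_congr this rfl rfl

theorem finite_cosetDivisor (a : ℂ) (R : ℝ) :
    {p | ‖p‖ ≤ R ∧ L.cosetDivisor a p ≠ 0}.Finite := by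
  refine ((L.finite_setOf_norm_le (R + ‖a‖)).image fun l : L.lattice => (l : ℂ) + a).subset ?_
  rintro p ⟨hp, h⟩
  have hm : p - a ∈ L.lattice := by
    by_contra h'
    exact h (if_neg h')
  exact ⟨⟨p - a, hm⟩, (norm_sub_le _ _).trans (by simpa using hp), by simp⟩

theorem finsum_cosetDivisor_mul (a : ℂ) {ψ : ℂ → ℝ} (hc : HasCompactSupport ψ) :
    ∑ᶠ p, (L.cosetDivisor a p : ℝ) * ψ p = L.periodize ψ a := by
  classical
  obtain ⟨S, hS, -⟩ := L.periodize_eventuallyEq hc a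
  rw [periodize, tsum_eq_sum hS]
  have hinj : Function.Injective fun l : L.lattice => a + (l : ℂ) := fun l m h => by
    simpa using h
  rw [finsum_eq_sum_of_support_subset (s := S.map ⟨_, hinj⟩), Finset.sum_map]
  · refine Finset.sum_congr rfl fun l _ => ?_
    simp [cosetDivisor]
  · intro p hp
    have hm : p - a ∈ L.lattice := by
      by_contra h'
      exact hp (by simp [cosetDivisor, h'])
    have hp' : (⟨p - a, hm⟩ : L.lattice) ∈ S := by
      by_contra h'
      have := hS _ h'
      simp only [add_sub_cancel] at this
      exact hp (by simp [this])
    simp only [Finset.coe_map, Function.Embedding.coeFn_mk, mem_image]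
    exact ⟨_, hp', by simp⟩

/-- Two divisors on the torus, one of which dominates the other, agree if they have the same degree;
the degree is computed with a smooth partition of unity `χ`. -/
theorem eq_of_le_of_finsum_mul_le {D E : ℂ → ℤ} (hED : E ≤ D)
    (hDp : ∀ l ∈ L.lattice, ∀ p, D (p + l) = D p) (hEp : ∀ l ∈ L.lattice, ∀ p, E (p + l) = E p)
    (hDf : ∀ R, {p | ‖p‖ ≤ R ∧ D p ≠ 0}.Finite) (hEf : ∀ R, {p | ‖p‖ ≤ R ∧ E p ≠ 0}.Finite)
    {χ : ℂ → ℝ} (hc : HasCompactSupport χ) (h0 : ∀ z, 0 ≤ χ z) (h1 : ∀ z, L.periodize χ z = 1)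
    (h : ∑ᶠ p, (D p : ℝ) * χ p ≤ ∑ᶠ p, (E p : ℝ) * χ p) : D = E := by
  classical
  obtain ⟨R, hR⟩ := hc.isBounded.exists_norm_le
  have hsupp : ∀ p, χ p ≠ 0 → ‖p‖ ≤ R := fun p hp => hR p (subset_tsupport χ hp)
  set S : Finset ℂ := (hDf R).toFinset ∪ (hEf R).toFinset with hSdef
  have hDs : (fun p => (D p : ℝ) * χ p).support ⊆ S := fun p hp => by
    have h2 := hsupp p (right_ne_zero_of_mul hp)
    have h3 : D p ≠ 0 := fun h' => hp (by simp [h'])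
    simp [hSdef, h2, h3]
  have hEs : (fun p => (E p : ℝ) * χ p).support ⊆ S := fun p hp => by
    have h2 := hsupp p (right_ne_zero_of_mul hp)
    have h3 : E p ≠ 0 := fun h' => hp (by simp [h'])
    simp [hSdef, h2, h3]
  rw [finsum_eq_sum_of_support_subset _ hDs, finsum_eq_sum_of_support_subset _ hEs] at h
  have hle : ∀ p ∈ S, (E p : ℝ) * χ p ≤ D p * χ p := fun p _ =>
    mul_le_mul_of_nonneg_right (by exact_mod_cast hED p) (h0 p)
  have heq := (Finset.sum_eq_sum_iff_of_le hle).mp (le_antisymm (Finset.sum_le_sum hle) h)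
  have hall : ∀ p, χ p ≠ 0 → D p = E p := by
    intro p hp
    by_cases hpS : p ∈ S
    · exact_mod_cast (mul_right_cancel₀ hp (heq p hpS)).symm
    · have h2 := hsupp p hp
      simp only [hSdef, Finset.mem_union, Finite.mem_toFinset, mem_ofPred_eq, not_or, not_and,
        not_not] at hpS
      rw [hpS.1 h2, hpS.2 h2]
  ext p
  obtain ⟨l, hl⟩ : ∃ l : L.lattice, χ (p + l) ≠ 0 := by
    by_contra! hno
    have := h1 p
    simp [periodize, hno] at this
  rw [← hDp l l.2 p, ← hEp l l.2 p]
  exact hall _ hl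

theorem integral_eq_area {χ : ℂ → ℝ} (hχ : Continuous χ) (hc : HasCompactSupport χ)
    (h1 : ∀ z, L.periodize χ z = 1) : ∫ z, χ z = L.area := by
  rw [L.integral_eq_integral_cell_periodize hχ hc]
  simp [h1, area]

/-- A periodic function integrates to zero against the Laplacian of a partition of unity. -/
theorem integral_mul_laplacian_eq_zero {u χ : ℂ → ℝ} (hu : L.IsPeriodic u)
    (hi : LocallyIntegrable u) (hχ : ContDiff ℝ ∞ χ) (hc : HasCompactSupport χ)
    (h1 : ∀ z, L.periodize χ z = 1) :
    ∫ z, u z * (Laplacian.laplacian χ : ℂ → ℝ) z = 0 := by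
  have := L.integral_cell_mul_laplacian hu hi (φ := fun _ => 1) contDiff_const
    (fun _ _ _ => rfl) hχ hc h1
  simpa using this.symm

theorem ae_ne_zero_of_meromorphic {f : ℂ → ℂ} (hord : ∀ p, meromorphicOrderAt f p ≠ ⊤)
    (hf : Meromorphic f) : ∀ᵐ z, f z ≠ 0 := by
  have h : {z | f z ≠ 0} ∈ codiscreteWithin (univ : Set ℂ) := by
    rw [mem_codiscreteWithin_iff_forall_mem_nhdsNE]
    intro x _
    filter_upwards [(meromorphicOrderAt_ne_top_iff_eventually_ne_zero (hf x)).mp (hord x)] with z hz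
    exact Or.inl hz
  have := ae_restrict_le_codiscreteWithin (μ := (volume : Measure ℂ)) MeasurableSet.univ h
  rwa [Measure.restrict_univ] at this

theorem finite_meromorphicOrderAt {f : ℂ → ℂ} (hf : Meromorphic f) (R : ℝ) :
    {p | ‖p‖ ≤ R ∧ (meromorphicOrderAt f p).untop₀ ≠ 0}.Finite := by
  have hfU : MeromorphicOn f (closedBall (0 : ℂ) R) := fun z _ => hf z
  refine ((MeromorphicOn.divisor f (closedBall (0 : ℂ) R)).finiteSupport
    (isCompact_closedBall 0 R)).subset ?_
  rintro p ⟨hp, h⟩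
  rw [Function.mem_support, hfU.divisor_apply (by simpa using hp)]
  exact h

section PeriodicModulus

variable {f : ℂ → ℂ} {A : ℂ → ℝ}

theorem log_norm_mul_exp_neg_ae (hf : Meromorphic f) (hord : ∀ p, meromorphicOrderAt f p ≠ ⊤) :
    (fun z => Real.log (‖f z‖ * Real.exp (-A z))) =ᵐ[volume]
      fun z => Real.log ‖f z‖ - A z := by
  filter_upwards [ae_ne_zero_of_meromorphic hord hf] with z hz
  rw [Real.log_mul (norm_ne_zero_iff.mpr hz) (Real.exp_pos _).ne', Real.log_exp]
  ring

theorem locallyIntegrable_log_norm_mul_exp_neg (hf : Meromorphic f)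
    (hord : ∀ p, meromorphicOrderAt f p ≠ ⊤) (hA : Continuous A) :
    LocallyIntegrable fun z => Real.log (‖f z‖ * Real.exp (-A z)) :=
  ((locallyIntegrable_log_norm hf hord).sub hA.locallyIntegrable).congr
    (log_norm_mul_exp_neg_ae hf hord).symm

/-- The distributional Laplacian of `log (‖f‖ exp (-A))`, where `f` is meromorphic and `A` has
constant Laplacian. -/
theorem integral_log_norm_mul_exp_neg_mul_laplacian (hf : Meromorphic f)
    (hord : ∀ p, meromorphicOrderAt f p ≠ ⊤) (hA : ContDiff ℝ ∞ A) {c : ℝ}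
    (hAc : ∀ z, (Laplacian.laplacian A : ℂ → ℝ) z = c)
    {ψ : ℂ → ℝ} (hψ : ContDiff ℝ ∞ ψ) (hc : HasCompactSupport ψ) :
    ∫ z, Real.log (‖f z‖ * Real.exp (-A z)) * (Laplacian.laplacian ψ : ℂ → ℝ) z =
      2 * π * ∑ᶠ p, ((meromorphicOrderAt f p).untop₀ : ℝ) * ψ p - c * ∫ z, ψ z := by
  have hL := hψ.laplacian.continuous
  obtain ⟨R, hR0, hR⟩ := hc.exists_tsupport_subset_ball
  calc _ = ∫ z, (Real.log ‖f z‖ * (Laplacian.laplacian ψ : ℂ → ℝ) z -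
        A z * (Laplacian.laplacian ψ : ℂ → ℝ) z) := by
        refine integral_congr_ae ?_
        filter_upwards [log_norm_mul_exp_neg_ae (A := A) hf hord] with z hz
        rw [hz, sub_mul]
    _ = _ := by
        rw [integral_sub, integral_log_norm_mul_laplacian_eq_finsum hf hord hψ hc,
          integral_mul_laplacian hR0 (fun z _ => hA.contDiffAt) hψ hR]
        · simp only [hAc, integral_const_mul]
        · simpa using (locallyIntegrable_log_norm hf hord).integrable_smul_right_of_hasCompactSupport
            hL hc.laplacian
        · exact (hA.continuous.mul hL).integrable_of_hasCompactSupport hc.laplacian.mul_left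

/-- If the modulus of a meromorphic function `f` is periodic up to a factor `exp A` with `ΔA = c`,
then a periodic divisor of degree `c |T| / 2π` that is dominated by the divisor of `f` is equal to
it. -/
theorem untop₀_meromorphicOrderAt_eq (hf : Meromorphic f)
    (hord : ∀ p, meromorphicOrderAt f p ≠ ⊤) (hA : ContDiff ℝ ∞ A) {c : ℝ}
    (hAc : ∀ z, (Laplacian.laplacian A : ℂ → ℝ) z = c)
    (hper : L.IsPeriodic fun z => ‖f z‖ * Real.exp (-A z))
    (hDp : ∀ l ∈ L.lattice, ∀ p, meromorphicOrderAt f (p + l) = meromorphicOrderAt f p)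
    {E : ℂ → ℤ} (hE : ∀ p, E p ≤ (meromorphicOrderAt f p).untop₀)
    (hEp : ∀ l ∈ L.lattice, ∀ p, E (p + l) = E p) (hEf : ∀ R, {p | ‖p‖ ≤ R ∧ E p ≠ 0}.Finite)
    (hdeg : ∀ χ : ℂ → ℝ, HasCompactSupport χ → (∀ z, L.periodize χ z = 1) →
      2 * π * ∑ᶠ p, (E p : ℝ) * χ p = c * L.area) (p : ℂ) :
    (meromorphicOrderAt f p).untop₀ = E p := by
  -- The degree of the divisor of `f` is found by testing `Δ log (‖f‖ exp (-A))` against `χ`.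
  obtain ⟨χ, hχ, hχc, hχ0, hχ1⟩ := L.exists_partition_of_unity
  have h1 := integral_log_norm_mul_exp_neg_mul_laplacian hf hord hA hAc hχ hχc
  rw [L.integral_mul_laplacian_eq_zero (fun l hl z => congrArg Real.log (hper l hl z))
    (locallyIntegrable_log_norm_mul_exp_neg hf hord hA.continuous) hχ hχc hχ1,
    L.integral_eq_area hχ.continuous hχc hχ1, ← hdeg χ hχc hχ1] at h1
  have h2 : ∑ᶠ p, ((meromorphicOrderAt f p).untop₀ : ℝ) * χ p = ∑ᶠ p, (E p : ℝ) * χ p := by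
    have := Real.pi_pos
    refine mul_left_cancel₀ (a := 2 * π) (by positivity) ?_
    linarith
  exact congrFun (L.eq_of_le_of_finsum_mul_le (D := fun p => (meromorphicOrderAt f p).untop₀) hE
    (fun l hl p => by simp only [hDp l hl p]) hEp
    (finite_meromorphicOrderAt hf) hEf hχc hχ0 hχ1 h2.le) p

end PeriodicModulus

end PeriodPair

/-! ### The theta function of the lattice -/

namespace PeriodPair

variable (L : PeriodPair)

theorem ω₁_ne_zero : L.ω₁ ≠ 0 := L.indep.ne_zero 0

theorem im_ω₂_div_ω₁_ne_zero : (L.ω₂ / L.ω₁).im ≠ 0 := by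
  intro h
  have h1 := L.ω₁_ne_zero
  have h2 : L.ω₂ = ((L.ω₂ / L.ω₁).re : ℂ) * L.ω₁ := by
    rw [← Complex.ext (z := L.ω₂ / L.ω₁) (w := ((L.ω₂ / L.ω₁).re : ℂ)) (by simp) (by simp [h])]
    field_simp
  have h3 := LinearIndependent.pair_iff.mp L.indep (L.ω₂ / L.ω₁).re (-1)
    (by simp only [real_smul]; rw [← h2]; simp)
  norm_num at h3

/-- The orientation of the pair of periods, `1` or `-1`. -/
noncomputable def orientation : ℝ := SignType.sign (L.ω₂ / L.ω₁).im

theorem orientation_mul_im : L.orientation * (L.ω₂ / L.ω₁).im = |(L.ω₂ / L.ω₁).im| :=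
  sign_mul_self _

theorem orientation_eq : L.orientation = 1 ∨ L.orientation = -1 := by
  rcases lt_or_gt_of_ne L.im_ω₂_div_ω₁_ne_zero with h | h
  · right; simp [orientation, sign_neg h]
  · left; simp [orientation, sign_pos h]

/-- The period ratio `± ω₂ / ω₁`, with the sign that puts it in the upper half plane. -/
noncomputable def ratio : ℂ := L.orientation * (L.ω₂ / L.ω₁)

theorem ratio_im : L.ratio.im = |(L.ω₂ / L.ω₁).im| := by
  rw [ratio, im_ofReal_mul, orientation_mul_im]

theorem ratio_im_pos : 0 < L.ratio.im := by
  rw [ratio_im]; exact abs_pos.mpr L.im_ω₂_div_ω₁_ne_zero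

theorem ratio_mul_ω₁ : L.ratio * L.ω₁ = L.orientation * L.ω₂ := by
  have := L.ω₁_ne_zero
  rw [ratio]; field_simp

/-- A property of complex numbers that is stable under addition and negation holds on the whole
lattice if it holds for `ω₁` and for `ratio * ω₁`. -/
theorem lattice_induction {P : ℂ → Prop} (h1 : P L.ω₁) (h2 : P (L.ratio * L.ω₁))
    (h0 : P 0) (hadd : ∀ a b, P a → P b → P (a + b)) (hneg : ∀ a, P a → P (-a))
    {l : ℂ} (hl : l ∈ L.lattice) : P l := by
  have h2' : P L.ω₂ := by
    rw [L.ratio_mul_ω₁] at h2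
    rcases L.orientation_eq with h | h
    · simpa [h] using h2
    · simpa [h] using hneg _ h2
  let H : AddSubgroup ℂ :=
    { carrier := {a | P a}, zero_mem' := h0, add_mem' := fun {a b} => hadd a b,
      neg_mem' := fun {a} => hneg a }
  have hle : L.lattice ≤ H.toIntSubmodule := by
    refine Submodule.span_le.mpr ?_
    rintro x (rfl | rfl)
    · exact h1
    · exact h2'
  exact hle hl

theorem area_eq : L.area = L.ratio.im * ‖L.ω₁‖ ^ 2 := by
  have hb : volume.real (ZSpan.fundamentalDomain Complex.basisOneI) = 1 := by
    rw [measureReal_congr (ZSpan.fundamentalDomain_ae_parallelepiped _ volume), measureReal_def,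
      ← Complex.toBasis_orthonormalBasisOneI, OrthonormalBasis.coe_toBasis,
      OrthonormalBasis.volume_parallelepiped, ENNReal.toReal_one]
  rw [area, cell, ZSpan.measureReal_fundamentalDomain _ _ Complex.basisOneI, hb, mul_one, ratio_im]
  have hn : 0 < ‖L.ω₁‖ ^ 2 := by have := norm_pos_iff.mpr L.ω₁_ne_zero; positivity
  conv_rhs => rw [← abs_of_pos hn, ← abs_mul]
  congr 1
  rw [Module.Basis.det_apply, Matrix.det_fin_two]
  simp only [Module.Basis.toMatrix_apply, basis_zero, basis_one, Complex.coe_basisOneI_repr,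
    Complex.div_im, Complex.sq_norm]
  have hns : normSq L.ω₁ ≠ 0 := by rw [← Complex.sq_norm]; exact hn.ne'
  simp
  field_simp

theorem area_pos : 0 < L.area := by
  rw [area_eq]
  have := norm_pos_iff.mpr L.ω₁_ne_zero
  have := L.ratio_im_pos
  positivity

/-- The Jacobi theta function of the lattice, shifted so that it vanishes at the lattice points. -/
noncomputable def theta (z : ℂ) : ℂ := jacobiTheta₂ (z / L.ω₁ + (1 + L.ratio) / 2) L.ratio

theorem differentiable_theta : Differentiable ℂ L.theta := fun z =>
  (differentiableAt_jacobiTheta₂_fst _ L.ratio_im_pos).comp z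
    (f := fun z => z / L.ω₁ + (1 + L.ratio) / 2) (by fun_prop)

theorem analyticAt_theta (z : ℂ) : AnalyticAt ℂ L.theta z :=
  L.differentiable_theta.analyticAt z

theorem theta_add_ω₁ (z : ℂ) : L.theta (z + L.ω₁) = L.theta z := by
  rw [theta, theta, ← jacobiTheta₂_add_left (z / L.ω₁ + (1 + L.ratio) / 2), add_div,
    div_self L.ω₁_ne_zero, add_right_comm]

theorem theta_add_ratio_mul (z : ℂ) : L.theta (z + L.ratio * L.ω₁) =
    cexp (-π * I * (2 * L.ratio + 1 + 2 * (z / L.ω₁))) * L.theta z := by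
  have h : (z + L.ratio * L.ω₁) / L.ω₁ + (1 + L.ratio) / 2 =
      z / L.ω₁ + (1 + L.ratio) / 2 + L.ratio := by
    field_simp [L.ω₁_ne_zero]
    ring
  rw [theta, theta, h, jacobiTheta₂_add_left']
  congr 2
  ring

theorem theta_zero : L.theta 0 = 0 := by
  have h1 : L.theta 0 = jacobiTheta₂ ((1 + L.ratio) / 2) L.ratio := by simp [theta]
  have h2 : jacobiTheta₂ ((1 + L.ratio) / 2) L.ratio =
      - jacobiTheta₂ ((1 + L.ratio) / 2) L.ratio := by
    calc _ = jacobiTheta₂ (-((1 + L.ratio) / 2) + 1 + L.ratio) L.ratio := by congr 1; ring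
      _ = cexp (-π * I) * jacobiTheta₂ (-((1 + L.ratio) / 2)) L.ratio := by
        rw [jacobiTheta₂_add_left', jacobiTheta₂_add_left]
        congr 2
        ring
      _ = _ := by
        rw [jacobiTheta₂_neg_left, neg_mul, Complex.exp_neg, Complex.exp_pi_mul_I]
        simp
  rw [h1]
  exact CharZero.eq_neg_self_iff.mp h2

/-- The Fourier coefficient of index zero of a Jacobi theta function is `1`. -/
theorem exists_jacobiTheta₂_ne_zero {τ : ℂ} (hτ : 0 < τ.im) : ∃ x : ℝ, jacobiTheta₂ x τ ≠ 0 := by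
  by_contra! h
  have hs : Summable fun n : ℤ => Real.exp (-π * (τ.im * n ^ 2 - 2 * 0 * |n|)) := by
    simpa using summable_pow_mul_jacobiTheta₂_term_bound 0 hτ 0
  have hcont : ∀ n : ℤ, Continuous fun x : ℝ => jacobiTheta₂_term n x τ := fun n => by
    unfold jacobiTheta₂_term; fun_prop
  have hsum := intervalIntegral.hasSum_integral_of_dominated_convergence (a := 0) (b := 1)
    (μ := volume) (F := fun (n : ℤ) (x : ℝ) => jacobiTheta₂_term n x τ)
    (f := fun x : ℝ => jacobiTheta₂ x τ)
    (fun n _ => Real.exp (-π * (τ.im * n ^ 2 - 2 * 0 * |n|)))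
    (fun n => (hcont n).aestronglyMeasurable)
    (fun n => .of_forall fun x _ => norm_jacobiTheta₂_term_le hτ (by simp) le_rfl n)
    (.of_forall fun x _ => hs) (by simp)
    (.of_forall fun x _ => hasSum_jacobiTheta₂_term x hτ)
  simp only [h, intervalIntegral.integral_zero] at hsum
  have hval : ∀ n : ℤ, (∫ x in (0 : ℝ)..1, jacobiTheta₂_term n x τ) = if n = 0 then 1 else 0 := by
    intro n
    split_ifs with hn
    · simp [hn, jacobiTheta₂_term]
    · have hc : (2 * π * I * n : ℂ) ≠ 0 := by
        have := Complex.two_pi_I_ne_zero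
        exact mul_ne_zero this (by exact_mod_cast hn)
      simp only [jacobiTheta₂_term, Complex.exp_add]
      rw [intervalIntegral.integral_mul_const, integral_exp_mul_complex hc]
      have : cexp (2 * π * I * n) = 1 := by
        rw [mul_comm]; exact Complex.exp_int_mul_two_pi_mul_I n
      simp [this]
  simp only [hval] at hsum
  have := hsum.unique (hasSum_ite_eq 0 1)
  norm_num at this

theorem exists_theta_ne_zero : ∃ z, L.theta z ≠ 0 := by
  obtain ⟨x, hx⟩ := exists_jacobiTheta₂_ne_zero L.ratio_im_pos
  refine ⟨(x - (1 + L.ratio) / 2) * L.ω₁, ?_⟩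
  rw [theta, mul_div_cancel_right₀ _ L.ω₁_ne_zero, sub_add_cancel]
  exact hx

theorem meromorphic_theta : Meromorphic L.theta := fun z => (L.analyticAt_theta z).meromorphicAt

theorem meromorphicOrderAt_ne_top_of_exists {f : ℂ → ℂ} (hf : Meromorphic f) {z : ℂ}
    (hz : meromorphicOrderAt f z ≠ ⊤) (p : ℂ) : meromorphicOrderAt f p ≠ ⊤ :=
  MeromorphicOn.meromorphicOrderAt_ne_top_of_isPreconnected (U := univ) (fun z _ => hf z)
    isPreconnected_univ (mem_univ z) (mem_univ p) hz

theorem meromorphicOrderAt_theta_ne_top (p : ℂ) : meromorphicOrderAt L.theta p ≠ ⊤ := by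
  obtain ⟨z, hz⟩ := L.exists_theta_ne_zero
  refine meromorphicOrderAt_ne_top_of_exists L.meromorphic_theta (z := z) ?_ p
  rw [meromorphicOrderAt_ne_top_iff_eventually_ne_zero (L.meromorphic_theta z)]
  exact ((L.analyticAt_theta z).continuousAt.eventually_ne hz).filter_mono nhdsWithin_le_nhds

theorem meromorphicOrderAt_theta_add {l : ℂ} (hl : l ∈ L.lattice) :
    ∀ p, meromorphicOrderAt L.theta (p + l) = meromorphicOrderAt L.theta p := by
  refine L.lattice_induction (P := fun l => ∀ p, meromorphicOrderAt L.theta (p + l) =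
    meromorphicOrderAt L.theta p) ?_ ?_ (by simp) ?_ ?_ hl
  · intro p
    rw [← meromorphicOrderAt_fun_comp_add_const_eq_meromorphicOrderAt]
    simp only [L.theta_add_ω₁]
  · intro p
    rw [← meromorphicOrderAt_fun_comp_add_const_eq_meromorphicOrderAt]
    simp only [L.theta_add_ratio_mul]
    exact meromorphicOrderAt_mul_of_ne_zero (by fun_prop) (Complex.exp_ne_zero _)
  · intro a b ha hb p
    rw [← add_assoc, hb, ha]
  · intro a ha p
    rw [← ha (p + -a), neg_add_cancel_right]

/-- The quadratic exponent that makes the modulus of `theta` periodic. -/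
noncomputable def thetaExponent (z : ℂ) : ℝ :=
  π * ((z / L.ω₁).im ^ 2 / L.ratio.im + (z / L.ω₁).im)

theorem isPeriodic_norm_theta_mul_exp :
    L.IsPeriodic fun z => ‖L.theta z‖ * Real.exp (-L.thetaExponent z) := by
  intro l hl
  have hω := L.ω₁_ne_zero
  have ht := L.ratio_im_pos.ne'
  refine L.lattice_induction (P := fun l => ∀ z, ‖L.theta (z + l)‖ *
    Real.exp (-L.thetaExponent (z + l)) = ‖L.theta z‖ * Real.exp (-L.thetaExponent z))
    ?_ ?_ (by simp) ?_ ?_ hl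
  · intro z
    simp only [L.theta_add_ω₁, thetaExponent, add_div, div_self hω]
    simp
  · intro z
    rw [L.theta_add_ratio_mul, norm_mul, Complex.norm_exp, mul_comm (Real.exp _), mul_assoc,
      ← Real.exp_add]
    congr 2
    simp only [thetaExponent, add_div, mul_div_cancel_right₀ _ hω]
    simp
    field_simp
    ring
  · intro a b ha hb z
    rw [← add_assoc, hb, ha]
  · intro a ha z
    rw [← ha (z + -a), neg_add_cancel_right]

theorem contDiff_thetaExponent : ContDiff ℝ ∞ L.thetaExponent := by
  have h : ContDiff ℝ ∞ fun z : ℂ => (z / L.ω₁).im :=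
    imCLM.contDiff.comp (contDiff_id.div_const _)
  exact contDiff_const.mul (((h.pow 2).div_const _).add h)

/-- The constant makes the zero divisor of `theta` have degree one on the torus. -/
theorem laplacian_thetaExponent (z : ℂ) :
    (Laplacian.laplacian L.thetaExponent : ℂ → ℝ) z = 2 * π / L.area := by
  have him : ∀ w, HasFDerivAt (fun z : ℂ => (z / L.ω₁).im)
      (imCLM.comp ((L.ω₁⁻¹ : ℂ) • (.id ℝ ℂ : ℂ →L[ℝ] ℂ))) w := fun w => by
    have := imCLM.hasFDerivAt.comp w (((hasFDerivAt_id (𝕜 := ℝ) w).const_smul L.ω₁⁻¹))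
    refine this.congr_of_eventuallyEq (.of_forall fun z => ?_)
    simp [div_eq_inv_mul]
  set C : ℂ →L[ℝ] ℝ := imCLM.comp ((L.ω₁⁻¹ : ℂ) • (.id ℝ ℂ : ℂ →L[ℝ] ℂ)) with hC
  have hA : ∀ w, HasFDerivAt L.thetaExponent
      ((π * (2 * (w / L.ω₁).im / L.ratio.im + 1)) • C) w := fun w => by
    have := (((((him w).mul (him w)).mul_const L.ratio.im⁻¹)).add (him w)).const_mul π
    refine (this.congr_of_eventuallyEq (.of_forall fun z => ?_)).congr_fderiv ?_
    · simp only [thetaExponent, Pi.add_apply, Pi.mul_apply]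
      ring
    · ext v
      simp
      ring
  have hA2 : ∀ v w, HasFDerivAt (fun w => fderiv ℝ L.thetaExponent w v)
      ((2 * π / L.ratio.im * C v) • C) w := fun v w => by
    have h1 : (fun w => fderiv ℝ L.thetaExponent w v) =
        fun w => (w / L.ω₁).im * (2 * π / L.ratio.im * C v) + π * C v := by
      ext w; rw [(hA w).fderiv]; simp; ring
    rw [h1]
    exact ((him w).mul_const _).add_const _
  rw [laplacian_eq_fderiv_fderiv (L.contDiff_thetaExponent.of_le (by norm_cast)),
    (hA2 _ z).fderiv, (hA2 _ z).fderiv, area_eq, Complex.sq_norm]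
  have hns : normSq L.ω₁ ≠ 0 := by simpa using L.ω₁_ne_zero
  have ht := L.ratio_im_pos.ne'
  simp [hC, Complex.inv_re, Complex.inv_im]
  field_simp
  rw [normSq_apply]
  ring

/-- The zeros of `theta` are simple and are the lattice points. -/
theorem untop₀_meromorphicOrderAt_theta (p : ℂ) :
    (meromorphicOrderAt L.theta p).untop₀ = L.cosetDivisor 0 p := by
  refine L.untop₀_meromorphicOrderAt_eq L.meromorphic_theta L.meromorphicOrderAt_theta_ne_top
    L.contDiff_thetaExponent L.laplacian_thetaExponent L.isPeriodic_norm_theta_mul_exp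
    (fun l hl => L.meromorphicOrderAt_theta_add hl) (fun p => ?_)
    (fun l hl => L.cosetDivisor_add_of_mem 0 hl) (L.finite_cosetDivisor 0) (fun χ hχ h1 => ?_) p
  · have hnn : 0 ≤ (meromorphicOrderAt L.theta p).untop₀ :=
      WithTop.untop₀_nonneg.mpr (L.analyticAt_theta p).meromorphicOrderAt_nonneg
    rw [cosetDivisor]
    split_ifs with h
    · have h0 := L.meromorphicOrderAt_theta_add h 0
      rw [sub_zero, zero_add] at h0
      rw [h0]
      have hpos : 0 < meromorphicOrderAt L.theta 0 := by
        rw [← tendsto_zero_iff_meromorphicOrderAt_pos (L.meromorphic_theta 0)]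
        have := (L.analyticAt_theta 0).continuousAt.tendsto
        rw [L.theta_zero] at this
        exact this.mono_left nhdsWithin_le_nhds
      have hne := L.meromorphicOrderAt_theta_ne_top 0
      lift meromorphicOrderAt L.theta 0 to ℤ using hne with n
      simp only [WithTop.untop₀_coe]
      exact_mod_cast hpos
    · exact hnn
  · rw [L.finsum_cosetDivisor_mul 0 hχ, h1]
    field_simp [L.area_pos.ne']

theorem theta_eq_zero_iff (z : ℂ) : L.theta z = 0 ↔ z ∈ L.lattice := by
  have h := L.untop₀_meromorphicOrderAt_theta z
  have hne := L.meromorphicOrderAt_theta_ne_top z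
  rw [cosetDivisor, sub_zero] at h
  have hord : meromorphicOrderAt L.theta z = 0 ↔ L.theta z ≠ 0 := by
    rw [← tendsto_ne_zero_iff_meromorphicOrderAt_eq_zero (L.meromorphic_theta z)]
    have ht : Tendsto L.theta (𝓝[≠] z) (𝓝 (L.theta z)) :=
      (L.analyticAt_theta z).continuousAt.tendsto.mono_left nhdsWithin_le_nhds
    exact ⟨fun ⟨c, hc, hc'⟩ => by rwa [tendsto_nhds_unique ht hc'], fun h => ⟨_, h, ht⟩⟩
  lift meromorphicOrderAt L.theta z to ℤ using hne with n
  simp only [WithTop.untop₀_coe] at h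
  rw [← not_iff_not, ← ne_eq, ← hord]
  split_ifs at h with hz <;> simp [h, hz]

end PeriodPair

/-! ### The Green function of the torus: existence and uniqueness -/

namespace PeriodPair

variable (L : PeriodPair)

/-- `log (‖θ‖ exp (-A))`, a logarithmic potential of the divisor `0` on the torus. -/
noncomputable def logTheta (z : ℂ) : ℝ :=
  Real.log (‖L.theta z‖ * Real.exp (-L.thetaExponent z))

/-- The Green function of the torus, in terms of the theta function. -/
noncomputable def green (z : ℂ) : ℝ :=
  -(2 * π)⁻¹ * (L.logTheta z - L.area⁻¹ * ∫ w in L.cell, L.logTheta w)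

theorem isPeriodic_logTheta : L.IsPeriodic L.logTheta := fun l hl z =>
  congrArg Real.log (L.isPeriodic_norm_theta_mul_exp l hl z)

theorem isPeriodic_green : L.IsPeriodic L.green := fun l hl z => by
  rw [green, green, L.isPeriodic_logTheta l hl z]

theorem locallyIntegrable_logTheta : LocallyIntegrable L.logTheta :=
  locallyIntegrable_log_norm_mul_exp_neg L.meromorphic_theta L.meromorphicOrderAt_theta_ne_top
    L.contDiff_thetaExponent.continuous

theorem locallyIntegrable_green : LocallyIntegrable L.green := by
  have h := (L.locallyIntegrable_logTheta.sub
    (locallyIntegrable_const (L.area⁻¹ * ∫ w in L.cell, L.logTheta w))).smul (-(2 * π)⁻¹)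
  exact h

theorem _root_.MeasureTheory.LocallyIntegrable.integrableOn_cell {u : ℂ → ℝ}
    (hu : LocallyIntegrable u) : IntegrableOn u L.cell := by
  obtain ⟨R, hR⟩ := L.isBounded_cell.subset_closedBall (0 : ℂ)
  exact (hu.integrableOn_isCompact (isCompact_closedBall 0 R)).mono_set hR

theorem volume_cell_ne_top : volume L.cell ≠ ⊤ := L.isBounded_cell.measure_lt_top.ne

theorem integral_cell_green : ∫ z in L.cell, L.green z = 0 := by
  have hi := L.locallyIntegrable_logTheta.integrableOn_cell L
  have hc : IntegrableOn (fun _ => L.area⁻¹ * ∫ w in L.cell, L.logTheta w) L.cell :=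
    integrableOn_const L.volume_cell_ne_top
  simp only [green]
  rw [integral_const_mul, integral_sub hi hc, setIntegral_const, smul_eq_mul, ← area,
    mul_inv_cancel_left₀ L.area_pos.ne', sub_self, mul_zero]

theorem continuousOn_green : ContinuousOn L.green ((L.lattice : Set ℂ)ᶜ) := by
  intro z hz
  have h0 : L.theta z ≠ 0 := fun h => hz ((L.theta_eq_zero_iff z).mp h)
  have h1 : ContinuousAt L.logTheta z :=
    (((L.analyticAt_theta z).continuousAt.norm).mul
      (L.contDiff_thetaExponent.continuous.continuousAt.neg.rexp)).log
      (mul_ne_zero (norm_ne_zero_iff.mpr h0) (Real.exp_pos _).ne')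
  exact (continuousAt_const.mul (h1.sub continuousAt_const)).continuousWithinAt

theorem integral_laplacian_eq_zero {ψ : ℂ → ℝ} (hψ : ContDiff ℝ ∞ ψ) (hc : HasCompactSupport ψ) :
    ∫ z, (Laplacian.laplacian ψ : ℂ → ℝ) z = 0 := by
  obtain ⟨R, hR0, hR⟩ := hc.exists_tsupport_subset_ball
  simpa using integral_mul_laplacian (u := fun _ => 1) hR0 (fun _ _ => contDiffAt_const) hψ hR

/-- The equation `-ΔG = ∑ δ_l - 1 / |T|` on the plane. -/
theorem integral_green_mul_laplacian {ψ : ℂ → ℝ} (hψ : ContDiff ℝ ∞ ψ)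
    (hc : HasCompactSupport ψ) :
    ∫ z, L.green z * (Laplacian.laplacian ψ : ℂ → ℝ) z =
      -L.periodize ψ 0 + L.area⁻¹ * ∫ z, ψ z := by
  have h1 := integral_log_norm_mul_exp_neg_mul_laplacian L.meromorphic_theta
    L.meromorphicOrderAt_theta_ne_top L.contDiff_thetaExponent L.laplacian_thetaExponent hψ hc
  simp only [L.untop₀_meromorphicOrderAt_theta, L.finsum_cosetDivisor_mul 0 hc] at h1
  have hL := hψ.laplacian.continuous
  have hi1 : Integrable fun z => L.logTheta z * (Laplacian.laplacian ψ : ℂ → ℝ) z := by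
    simpa using L.locallyIntegrable_logTheta.integrable_smul_right_of_hasCompactSupport hL
      hc.laplacian
  have hi2 : Integrable (Laplacian.laplacian ψ : ℂ → ℝ) :=
    hL.integrable_of_hasCompactSupport hc.laplacian
  simp only [green, mul_assoc, sub_mul]
  rw [integral_const_mul, integral_sub hi1 ((hi2.const_mul _).const_mul _), integral_const_mul,
    integral_const_mul, integral_laplacian_eq_zero hψ hc]
  simp only [logTheta]
  rw [h1]
  have := Real.pi_pos.ne'
  have := L.area_pos.ne'
  field_simp
  ring

theorem isGreenFunction_green : L.IsGreenFunction L.green where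
  periodic := L.isPeriodic_green
  continuousOn := L.continuousOn_green
  integrableOn := L.locallyIntegrable_green.integrableOn_cell L
  integral_eq_zero := L.integral_cell_green
  neg_laplacian_eq φ hφ hφp := by
    obtain ⟨χ, hχ, hχc, -, hχ1⟩ := L.exists_partition_of_unity
    have hc : HasCompactSupport fun w => χ w * φ w := hχc.mul_right
    have hper : L.periodize (fun w => χ w * φ w) = φ := by
      ext z; rw [L.periodize_mul hφp, hχ1, one_mul]
    simp only [mul_neg]
    rw [integral_neg, L.integral_cell_mul_laplacian L.isPeriodic_green L.locallyIntegrable_green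
      hφ hφp hχ hχc hχ1, L.integral_green_mul_laplacian (hχ.mul hφ) hc,
      L.integral_eq_integral_cell_periodize (hχ.mul hφ).continuous hc, hper]
    ring

open ContinuousLinearMap in
/-- The convolution of the Green function with a test function solves the Poisson equation on the
torus. -/
theorem exists_laplacian_eq {χ : ℂ → ℝ} (hχ : ContDiff ℝ ∞ χ) (hc : HasCompactSupport χ) :
    ∃ φ : ℂ → ℝ, ContDiff ℝ ∞ φ ∧ L.IsPeriodic φ ∧
      ∀ z, (Laplacian.laplacian φ : ℂ → ℝ) z = -L.periodize χ z + L.area⁻¹ * ∫ w, χ w := by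
  have hG := L.locallyIntegrable_green
  -- Derivatives fall on the smooth factor, so the Laplacian of the convolution is an integral of
  -- `green` against the Laplacian of a reflected translate of `χ`.
  let conv : (ℂ → ℝ) → ℂ → ℝ := fun g => convolution L.green g (mul ℝ ℝ) volume
  have hfd : ∀ g : ℂ → ℝ, ContDiff ℝ ∞ g → HasCompactSupport g → ∀ v : ℂ,
      (fun z => fderiv ℝ (conv g) z v) = conv fun w => fderiv ℝ g w v := by
    intro g hg hgc v
    ext z
    have hg1 : ContDiff ℝ 1 g := hg.of_le (by norm_cast)
    rw [(hgc.hasFDerivAt_convolution_right (mul ℝ ℝ) hG hg1 z).fderiv,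
      convolution_precompR_apply (mul ℝ ℝ) hG (hgc.fderiv ℝ)
      (hg1.continuous_fderiv one_ne_zero)]
  have hsm : ∀ g : ℂ → ℝ, ContDiff ℝ ∞ g → ∀ v : ℂ, ContDiff ℝ ∞ fun w => fderiv ℝ g w v :=
    fun g hg v => (hg.fderiv_right (m := ∞) (by simp)).clm_apply contDiff_const
  have hcs : ∀ g : ℂ → ℝ, HasCompactSupport g → ∀ v : ℂ,
      HasCompactSupport fun w => fderiv ℝ g w v := fun g hg v => hg.fderiv_apply ℝ v
  have hφ : ContDiff ℝ ∞ (conv χ) := hc.contDiff_convolution_right (mul ℝ ℝ) hG hχ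
  have htwo : (2 : WithTop ℕ∞) ≤ ∞ := by norm_cast
  refine ⟨conv χ, hφ, fun l hl z => ?_, fun z => ?_⟩
  · simp only [conv, convolution_def, mul_apply']
    rw [← integral_add_right_eq_self _ l]
    congr 1 with w
    rw [L.isPeriodic_green l hl, add_sub_add_right_eq_sub]
  · rw [laplacian_eq_fderiv_fderiv (hφ.of_le htwo), hfd χ hχ hc, hfd χ hχ hc,
      congrFun (hfd _ (hsm χ hχ 1) (hcs χ hc 1) 1) z,
      congrFun (hfd _ (hsm χ hχ I) (hcs χ hc I) I) z]
    have hint : ∀ g : ℂ → ℝ, ContDiff ℝ ∞ g → HasCompactSupport g →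
        Integrable fun t => L.green t * g (z - t) := fun g hg hgc => by
      simpa using hG.integrable_smul_right_of_hasCompactSupport
        (hg.continuous.comp (continuous_const.sub continuous_id))
        (hgc.comp_homeomorph (Homeomorph.subLeft z))
    simp only [conv, convolution_def, mul_apply']
    rw [← integral_add (hint _ (hsm _ (hsm χ hχ 1) 1) (hcs _ (hcs χ hc 1) 1))
      (hint _ (hsm _ (hsm χ hχ I) I) (hcs _ (hcs χ hc I) I))]
    simp only [← mul_add, ← laplacian_eq_fderiv_fderiv (hχ.of_le htwo)]
    simp only [← laplacian_comp_const_sub (hχ.of_le htwo)]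
    have hs : ContDiff ℝ ∞ fun w => χ (z - w) := hχ.comp (contDiff_const.sub contDiff_id)
    have hsc : HasCompactSupport fun w => χ (z - w) := hc.comp_homeomorph (Homeomorph.subLeft z)
    rw [L.integral_green_mul_laplacian hs hsc, integral_sub_left_eq_self χ volume z]
    congr 2
    rw [periodize, periodize, ← (Equiv.neg L.lattice).tsum_eq fun l => χ (z + l)]
    simp [sub_eq_add_neg]

/-- Weyl's lemma on the torus: a distributionally harmonic function is constant. -/
theorem ae_eq_const_of_harmonic {u : ℂ → ℝ} (hu : L.IsPeriodic u) (hi : IntegrableOn u L.cell)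
    (h : ∀ φ : ℂ → ℝ, ContDiff ℝ ∞ φ → L.IsPeriodic φ →
      ∫ z in L.cell, u z * (Laplacian.laplacian φ : ℂ → ℝ) z = 0) :
    ∀ᵐ z, u z = L.area⁻¹ * ∫ w in L.cell, u w := by
  have hl := IsPeriodic.locallyIntegrable L hu hi
  -- Testing against the solution `φ` of `Δφ = -periodize χ + const` computes `∫ u χ`.
  refine ae_eq_of_integral_contDiff_smul_eq hl (locallyIntegrable_const _) fun χ hχ hc => ?_
  obtain ⟨φ, hφ, hφp, hΔ⟩ := L.exists_laplacian_eq hχ hc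
  have h1 := h φ hφ hφp
  simp only [hΔ] at h1
  have hPc : Continuous (L.periodize χ) := (L.contDiff_periodize hχ hc).continuous
  have hi1 : IntegrableOn (fun z => u z * L.periodize χ z) L.cell := by
    have : LocallyIntegrable fun z => u z * L.periodize χ z := by
      simpa [mul_comm] using hl.smul_continuous hPc
    exact this.integrableOn_cell L
  have h2 : ∫ z in L.cell, u z * (-L.periodize χ z + L.area⁻¹ * ∫ w, χ w) =
      -(∫ z in L.cell, u z * L.periodize χ z) +
        (∫ z in L.cell, u z) * (L.area⁻¹ * ∫ w, χ w) := by
    simp only [mul_add, mul_neg]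
    have hn : IntegrableOn (fun z => -(u z * L.periodize χ z)) L.cell := hi1.neg
    rw [integral_add hn (hi.mul_const _), integral_neg, integral_mul_const]
  rw [h2, ← L.integral_mul_eq_integral_cell_mul_periodize hu hl hχ.continuous hc] at h1
  simp only [smul_eq_mul, integral_mul_const]
  rw [← sub_eq_zero, ← neg_eq_zero, ← h1]
  simp only [mul_comm (u _)]
  ring

/-- Uniqueness: the difference of two Green functions is distributionally harmonic with mean zero. -/
theorem IsGreenFunction.eqOn {G G' : ℂ → ℝ} (hG : L.IsGreenFunction G)
    (hG' : L.IsGreenFunction G') : EqOn G G' ((L.lattice : Set ℂ)ᶜ) := by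
  have hu : L.IsPeriodic fun z => G z - G' z := fun l hl z => by
    simp only [hG.periodic l hl z, hG'.periodic l hl z]
  have hbd : ∀ φ : ℂ → ℝ, ContDiff ℝ ∞ φ → ∀ K : ℂ → ℝ, L.IsGreenFunction K →
      IntegrableOn (fun z => K z * (Laplacian.laplacian φ : ℂ → ℝ) z) L.cell := by
    intro φ hφ K hK
    have : LocallyIntegrable fun z => K z * (Laplacian.laplacian φ : ℂ → ℝ) z := by
      simpa [mul_comm] using (IsPeriodic.locallyIntegrable L hK.periodic
        hK.integrableOn).smul_continuous hφ.laplacian.continuous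
    exact this.integrableOn_cell L
  have hae := L.ae_eq_const_of_harmonic hu (hG.integrableOn.sub hG'.integrableOn)
    fun φ hφ hφp => by
      have h1 := hG.neg_laplacian_eq φ hφ hφp
      have h2 := hG'.neg_laplacian_eq φ hφ hφp
      simp only [mul_neg, integral_neg] at h1 h2
      simp only [sub_mul]
      rw [integral_sub (hbd φ hφ G hG) (hbd φ hφ G' hG')]
      linarith
  rw [integral_sub hG.integrableOn hG'.integrableOn, hG.integral_eq_zero,
    hG'.integral_eq_zero, sub_zero, mul_zero] at hae
  refine Measure.eqOn_open_of_ae_eq (μ := volume) (ae_restrict_of_ae ?_)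
    L.isClosed_lattice.isOpen_compl hG.continuousOn hG'.continuousOn
  filter_upwards [hae] with z hz using sub_eq_zero.mp hz

end PeriodPair

/-! ### The Weierstrass function at the half periods -/

/-- Distinct roots of `4 X³ - g₂ X - g₃` sum to zero. -/
theorem add_add_eq_zero_of_cubic {x y z g h : ℂ} (hxy : x ≠ y) (hyz : y ≠ z) (hxz : x ≠ z)
    (hx : 4 * x ^ 3 - g * x - h = 0) (hy : 4 * y ^ 3 - g * y - h = 0)
    (hz : 4 * z ^ 3 - g * z - h = 0) : x + y + z = 0 := by
  have h1 : 4 * (x ^ 2 + x * y + y ^ 2) - g = 0 := by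
    refine mul_left_cancel₀ (sub_ne_zero.mpr hxy) ?_
    linear_combination hx - hy
  have h2 : 4 * (y ^ 2 + y * z + z ^ 2) - g = 0 := by
    refine mul_left_cancel₀ (sub_ne_zero.mpr hyz) ?_
    linear_combination hy - hz
  refine mul_left_cancel₀ (sub_ne_zero.mpr hxz) ?_
  linear_combination (h1 - h2) / 4

/-- `‖2x + y‖² - ‖2y + x‖² = 3 (‖x‖² - ‖y‖²)`. -/
theorem norm_two_mul_add_le_iff (x y : ℂ) : ‖2 * y + x‖ ≤ ‖2 * x + y‖ ↔ ‖y‖ ≤ ‖x‖ := by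
  rw [← sq_le_sq₀ (norm_nonneg _) (norm_nonneg _), ← sq_le_sq₀ (norm_nonneg y) (norm_nonneg _)]
  simp only [Complex.sq_norm, normSq_apply]
  simp
  constructor <;> intro h <;> nlinarith

namespace PeriodPair

variable (L : PeriodPair)

/-- The divisor `2 (a) - 2 (0)` of `℘ - ℘ a`, for a half period `a`. -/
noncomputable def halfPeriodDivisor (a p : ℂ) : ℤ := 2 * L.cosetDivisor a p - 2 * L.cosetDivisor 0 p

theorem finsum_halfPeriodDivisor_mul (a : ℂ) {ψ : ℂ → ℝ} (hc : HasCompactSupport ψ) :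
    ∑ᶠ p, (L.halfPeriodDivisor a p : ℝ) * ψ p = 2 * (L.periodize ψ a - L.periodize ψ 0) := by
  obtain ⟨R, hR⟩ := hc.isBounded.exists_norm_le
  have hfin : ∀ b, Function.HasFiniteSupport fun p => (L.cosetDivisor b p : ℝ) * ψ p := fun b =>
    (L.finite_cosetDivisor b R).subset fun p hp =>
      ⟨hR p (subset_tsupport ψ (right_ne_zero_of_mul hp)), by
        exact_mod_cast left_ne_zero_of_mul hp⟩
  rw [← L.finsum_cosetDivisor_mul a hc, ← L.finsum_cosetDivisor_mul 0 hc,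
    ← finsum_sub_distrib (hfin a) (hfin 0), mul_finsum]
  refine finsum_congr fun p => ?_
  rw [halfPeriodDivisor]
  push_cast
  ring

variable {a : ℂ}

theorem meromorphic_weierstrassP_sub (a : ℂ) :
    Meromorphic fun z => L.weierstrassP z - L.weierstrassP a := fun z =>
  (L.meromorphic_weierstrassP z).sub (MeromorphicAt.const _ _)

theorem meromorphicOrderAt_weierstrassP_sub {l : ℂ} (hl : l ∈ L.lattice) (a : ℂ) :
    meromorphicOrderAt (fun z => L.weierstrassP z - L.weierstrassP a) l = -2 := by
  have h := L.order_weierstrassP l hl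
  rw [← h]
  simp only [sub_eq_add_neg]
  refine meromorphicOrderAt_add_eq_left_of_lt (MeromorphicAt.const _ _) ?_
  rw [h]
  exact lt_of_lt_of_le (by decide) analyticAt_const.meromorphicOrderAt_nonneg

theorem meromorphicOrderAt_weierstrassP_sub_ne_top (a p : ℂ) :
    meromorphicOrderAt (fun z => L.weierstrassP z - L.weierstrassP a) p ≠ ⊤ := by
  refine meromorphicOrderAt_ne_top_of_exists (L.meromorphic_weierstrassP_sub a) (z := 0) ?_ p
  rw [L.meromorphicOrderAt_weierstrassP_sub L.lattice.zero_mem]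
  decide

theorem weierstrassP_add_of_mem {l : ℂ} (hl : l ∈ L.lattice) (z : ℂ) :
    L.weierstrassP (z + l) = L.weierstrassP z := L.weierstrassP_add_coe z ⟨l, hl⟩

theorem derivWeierstrassP_eq_zero (h2 : 2 * a ∈ L.lattice) : L.derivWeierstrassP a = 0 := by
  have h := L.derivWeierstrassP_add_coe (-a) ⟨2 * a, h2⟩
  rw [show -a + (2 * a : ℂ) = a by ring, L.derivWeierstrassP_neg] at h
  exact CharZero.eq_neg_self_iff.mp h

/-- At a half period `℘` takes its value with multiplicity at least two. -/
theorem two_le_meromorphicOrderAt_weierstrassP_sub (ha : a ∉ L.lattice) (h2 : 2 * a ∈ L.lattice) :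
    2 ≤ meromorphicOrderAt (fun z => L.weierstrassP z - L.weierstrassP a) a := by
  have hP := L.analyticOnNhd_weierstrassP a ha
  have hA : AnalyticAt ℂ (fun z => L.weierstrassP z - L.weierstrassP a) a :=
    hP.sub analyticAt_const
  have h : ((2 : ℕ) : ℕ∞) ≤
      analyticOrderAt (fun z => L.weierstrassP z - L.weierstrassP a) a := by
    rw [natCast_le_analyticOrderAt_iff_iteratedDeriv_eq_zero hA]
    intro i hi
    interval_cases i
    · simp
    · simp [L.derivWeierstrassP_eq_zero h2]
  rw [hA.meromorphicOrderAt_eq]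
  cases hn : analyticOrderAt (fun z => L.weierstrassP z - L.weierstrassP a) a with
  | top => simp
  | coe n =>
    rw [hn] at h
    have : (2 : ℤ) ≤ n := by exact_mod_cast h
    simpa using WithTop.coe_le_coe.mpr this

theorem meromorphicOrderAt_weierstrassP_sub_add {l : ℂ} (hl : l ∈ L.lattice) (a p : ℂ) :
    meromorphicOrderAt (fun z => L.weierstrassP z - L.weierstrassP a) (p + l) =
      meromorphicOrderAt (fun z => L.weierstrassP z - L.weierstrassP a) p := by
  rw [← meromorphicOrderAt_fun_comp_add_const_eq_meromorphicOrderAt]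
  simp only [L.weierstrassP_add_of_mem hl]

/-- `℘ - ℘ a` has no zeros besides the double zero at the half period `a`. -/
theorem untop₀_meromorphicOrderAt_weierstrassP_sub (ha : a ∉ L.lattice) (h2 : 2 * a ∈ L.lattice)
    (p : ℂ) :
    (meromorphicOrderAt (fun z => L.weierstrassP z - L.weierstrassP a) p).untop₀ =
      L.halfPeriodDivisor a p := by
  refine L.untop₀_meromorphicOrderAt_eq (A := fun _ => 0) (c := 0)
    (L.meromorphic_weierstrassP_sub a) (L.meromorphicOrderAt_weierstrassP_sub_ne_top a)
    contDiff_const (fun z => by simp) (fun l hl z => by simp only [L.weierstrassP_add_of_mem hl])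
    (fun l hl => L.meromorphicOrderAt_weierstrassP_sub_add hl a) (fun p => ?_)
    (fun l hl p => by simp only [halfPeriodDivisor, L.cosetDivisor_add_of_mem _ hl])
    (fun R => ?_) (fun χ hχ h1 => ?_) p
  · have hne := L.meromorphicOrderAt_weierstrassP_sub_ne_top a p
    rw [halfPeriodDivisor, cosetDivisor, cosetDivisor, sub_zero]
    by_cases hp : p ∈ L.lattice
    · have hpa : p - a ∉ L.lattice := fun h => ha (by simpa using L.lattice.sub_mem hp h)
      rw [if_neg hpa, if_pos hp, L.meromorphicOrderAt_weierstrassP_sub hp]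
      decide
    rw [if_neg hp]
    by_cases hpa : p - a ∈ L.lattice
    · have h := L.two_le_meromorphicOrderAt_weierstrassP_sub ha h2
      rw [← L.meromorphicOrderAt_weierstrassP_sub_add hpa, add_sub_cancel] at h
      rw [if_pos hpa]
      lift meromorphicOrderAt (fun z => L.weierstrassP z - L.weierstrassP a) p to ℤ using hne with n
      simpa using WithTop.coe_le_coe.mp h
    · rw [if_neg hpa]
      have hA : AnalyticAt ℂ (fun z => L.weierstrassP z - L.weierstrassP a) p :=
        (L.analyticOnNhd_weierstrassP p hp).sub analyticAt_const
      simpa using WithTop.untop₀_nonneg.mpr hA.meromorphicOrderAt_nonneg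
  · refine ((L.finite_cosetDivisor a R).union (L.finite_cosetDivisor 0 R)).subset ?_
    rintro p ⟨hp, h⟩
    by_contra hno
    simp only [mem_union, mem_ofPred_eq, not_or, not_and, not_not] at hno
    exact h (by simp [halfPeriodDivisor, hno.1 hp, hno.2 hp])
  · rw [L.finsum_halfPeriodDivisor_mul a hχ, h1, h1]
    simp

theorem weierstrassP_sub_ne_zero (ha : a ∉ L.lattice) (h2 : 2 * a ∈ L.lattice) {z : ℂ}
    (hz : z ∉ L.lattice) (hza : z - a ∉ L.lattice) : L.weierstrassP z - L.weierstrassP a ≠ 0 := by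
  intro h0
  have h := L.untop₀_meromorphicOrderAt_weierstrassP_sub ha h2 z
  have hne := L.meromorphicOrderAt_weierstrassP_sub_ne_top a z
  have hA : AnalyticAt ℂ (fun z => L.weierstrassP z - L.weierstrassP a) z :=
    (L.analyticOnNhd_weierstrassP z hz).sub analyticAt_const
  have hpos : 0 < meromorphicOrderAt (fun z => L.weierstrassP z - L.weierstrassP a) z := by
    rw [← tendsto_zero_iff_meromorphicOrderAt_pos hA.meromorphicAt]
    have := hA.continuousAt.tendsto
    simp only [h0] at this
    exact this.mono_left nhdsWithin_le_nhds
  rw [halfPeriodDivisor, cosetDivisor, cosetDivisor, sub_zero, if_neg hz, if_neg hza] at h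
  lift meromorphicOrderAt (fun z => L.weierstrassP z - L.weierstrassP a) z to ℤ using hne with n
  simp only [WithTop.untop₀_coe] at h
  simp [h] at hpos

theorem integral_log_norm_weierstrassP_sub_mul_laplacian (ha : a ∉ L.lattice)
    (h2 : 2 * a ∈ L.lattice) {ψ : ℂ → ℝ} (hψ : ContDiff ℝ ∞ ψ) (hc : HasCompactSupport ψ) :
    ∫ z, Real.log ‖L.weierstrassP z - L.weierstrassP a‖ * (Laplacian.laplacian ψ : ℂ → ℝ) z =
      4 * π * (L.periodize ψ a - L.periodize ψ 0) := by
  rw [integral_log_norm_mul_laplacian_eq_finsum (L.meromorphic_weierstrassP_sub a)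
    (L.meromorphicOrderAt_weierstrassP_sub_ne_top a) hψ hc]
  simp only [L.untop₀_meromorphicOrderAt_weierstrassP_sub ha h2]
  rw [L.finsum_halfPeriodDivisor_mul a hc]
  ring

theorem locallyIntegrable_green_sub (a : ℂ) : LocallyIntegrable fun z => L.green (z - a) := by
  refine IsPeriodic.locallyIntegrable L (fun l hl z => ?_) ?_
  · rw [add_sub_right_comm, L.isPeriodic_green l hl]
  · obtain ⟨R, hR⟩ := L.isBounded_cell.subset_closedBall (0 : ℂ)
    refine IntegrableOn.mono_set ?_ hR
    have h := L.locallyIntegrable_green.integrableOn_isCompact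
      ((isCompact_closedBall (0 : ℂ) R).image (continuous_sub_right a))
    exact ((measurePreserving_sub_right volume a).integrableOn_image
      (MeasurableEquiv.subRight a).measurableEmbedding).mp h

/-- The translate `G(· - a)` of the Green function has its pole at `a`. -/
theorem integral_green_sub_mul_laplacian (a : ℂ) {ψ : ℂ → ℝ} (hψ : ContDiff ℝ ∞ ψ)
    (hc : HasCompactSupport ψ) :
    ∫ z, L.green (z - a) * (Laplacian.laplacian ψ : ℂ → ℝ) z =
      -L.periodize ψ a + L.area⁻¹ * ∫ z, ψ z := by
  have hs : ContDiff ℝ ∞ fun w => ψ (w + a) := hψ.comp (contDiff_id.add contDiff_const)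
  have hsc : HasCompactSupport fun w => ψ (w + a) := hc.comp_homeomorph (Homeomorph.addRight a)
  have h := L.integral_green_mul_laplacian hs hsc
  rw [integral_add_right_eq_self ψ a] at h
  rw [← integral_add_right_eq_self _ a]
  simp only [add_sub_cancel_right]
  simp only [laplacian_comp_add_right] at h
  rw [h]
  simp [periodize, add_comm]

/-- The identity `log |℘(z) - ℘(a)| = 4π (G(z) - G(z - a)) + C` for a half period `a`: both sides
have the same distributional Laplacian. -/
theorem exists_log_norm_weierstrassP_sub_eq (ha : a ∉ L.lattice) (h2 : 2 * a ∈ L.lattice) :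
    ∃ C, ∀ z, z ∉ L.lattice → z - a ∉ L.lattice →
      Real.log ‖L.weierstrassP z - L.weierstrassP a‖ =
        4 * π * (L.green z - L.green (z - a)) + C := by
  have hl1 := locallyIntegrable_log_norm (L.meromorphic_weierstrassP_sub a)
    (L.meromorphicOrderAt_weierstrassP_sub_ne_top a)
  have hl2 := L.locallyIntegrable_green
  have hl3 := L.locallyIntegrable_green_sub a
  set H : ℂ → ℝ := fun z => Real.log ‖L.weierstrassP z - L.weierstrassP a‖ -
    4 * π * (L.green z - L.green (z - a)) with hH
  have hHp : L.IsPeriodic H := fun l hl z => by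
    simp only [hH, L.weierstrassP_add_of_mem hl, L.isPeriodic_green l hl, add_sub_right_comm]
  have hHl : LocallyIntegrable H := hl1.sub ((hl2.sub hl3).smul (4 * π))
  have hplane : ∀ ψ : ℂ → ℝ, ContDiff ℝ ∞ ψ → HasCompactSupport ψ →
      ∫ z, H z * (Laplacian.laplacian ψ : ℂ → ℝ) z = 0 := by
    intro ψ hψ hc
    have hint : ∀ u : ℂ → ℝ, LocallyIntegrable u →
        Integrable fun z => u z * (Laplacian.laplacian ψ : ℂ → ℝ) z := fun u hu => by
      simpa using hu.integrable_smul_right_of_hasCompactSupport hψ.laplacian.continuous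
        hc.laplacian
    simp only [hH, sub_mul, mul_assoc]
    have hi : Integrable fun z => L.green z * (Laplacian.laplacian ψ : ℂ → ℝ) z -
        L.green (z - a) * (Laplacian.laplacian ψ : ℂ → ℝ) z := (hint _ hl2).sub (hint _ hl3)
    rw [integral_sub (hint _ hl1) ((hi.const_mul π).const_mul 4),
      integral_const_mul, integral_const_mul, integral_sub (hint _ hl2) (hint _ hl3),
      L.integral_log_norm_weierstrassP_sub_mul_laplacian ha h2 hψ hc,
      L.integral_green_mul_laplacian hψ hc, L.integral_green_sub_mul_laplacian a hψ hc]
    ring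
  obtain ⟨χ, hχ, hχc, -, hχ1⟩ := L.exists_partition_of_unity
  have hae := L.ae_eq_const_of_harmonic hHp (hHl.integrableOn_cell L) fun φ hφ hφp => by
    rw [L.integral_cell_mul_laplacian hHp hHl hφ hφp hχ hχc hχ1]
    exact hplane _ (hχ.mul hφ) hχc.mul_right
  set C := L.area⁻¹ * ∫ w in L.cell, H w
  refine ⟨C, fun z hz hza => ?_⟩
  set U : Set ℂ := {z | z ∉ L.lattice ∧ z - a ∉ L.lattice} with hU
  have hUo : IsOpen U := L.isClosed_lattice.isOpen_compl.inter
    (L.isClosed_lattice.isOpen_compl.preimage (continuous_sub_right a))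
  have hHc : ContinuousOn H U := by
    refine ContinuousOn.sub (ContinuousOn.log ?_ fun w hw => ?_)
      (continuousOn_const.mul (ContinuousOn.sub ?_ ?_))
    · exact ((L.analyticOnNhd_weierstrassP.continuousOn.mono fun w hw => hw.1).sub
        continuousOn_const).norm
    · exact norm_ne_zero_iff.mpr (L.weierstrassP_sub_ne_zero ha h2 hw.1 hw.2)
    · exact L.continuousOn_green.mono fun w hw => hw.1
    · exact L.continuousOn_green.comp (continuous_sub_right a).continuousOn fun w hw => hw.2
  have := Measure.eqOn_open_of_ae_eq (μ := volume) (ae_restrict_of_ae hae) hUo hHc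
    continuousOn_const (⟨hz, hza⟩ : z ∈ U)
  simp only [hH] at this
  linarith

theorem IsHalfPeriodPoint.notMem_lattice {L : PeriodPair} {z : ℂ} (hz : L.IsHalfPeriodPoint z) :
    z ∉ L.lattice := by
  obtain ⟨l, hl, rfl | rfl | rfl⟩ := hz
  · exact fun h => L.ω₁_div_two_notMem_lattice ((L.lattice.add_mem_iff_left hl).mp h)
  · exact fun h => L.ω₂_div_two_notMem_lattice ((L.lattice.add_mem_iff_left hl).mp h)
  · intro h
    have h1 := (L.lattice.add_mem_iff_left hl).mp h
    have h2 := (L.mul_ω₁_add_mul_ω₂_mem_lattice (α := 1 / 2) (β := 1 / 2)).not.mpr (by norm_num)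
    refine h2 ?_
    convert h1 using 1
    push_cast
    ring

theorem IsHalfPeriodPoint.two_mul_mem_lattice {L : PeriodPair} {z : ℂ}
    (hz : L.IsHalfPeriodPoint z) : 2 * z ∈ L.lattice := by
  have h1 := L.ω₁_mem_lattice
  have h2 := L.ω₂_mem_lattice
  obtain ⟨l, hl, rfl | rfl | rfl⟩ := hz
  · rw [show 2 * (L.ω₁ / 2 + l) = L.ω₁ + (l + l) by ring]
    exact L.lattice.add_mem h1 (L.lattice.add_mem hl hl)
  · rw [show 2 * (L.ω₂ / 2 + l) = L.ω₂ + (l + l) by ring]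
    exact L.lattice.add_mem h2 (L.lattice.add_mem hl hl)
  · rw [show 2 * ((L.ω₁ + L.ω₂) / 2 + l) = L.ω₁ + L.ω₂ + (l + l) by ring]
    exact L.lattice.add_mem (L.lattice.add_mem h1 h2) (L.lattice.add_mem hl hl)

/-- The values of `G` at two half periods `a`, `b` are compared by evaluating the formula for
`log |℘ - ℘(a - b)|` at `a` and at `b`; since the three half-period values of `℘` sum to zero, the
resulting inequality is one between `|2 ℘(a) + ℘(b)|` and `|2 ℘(b) + ℘(a)|`. -/
theorem green_le_green_iff {a b : ℂ} (ha : a ∉ L.lattice) (ha2 : 2 * a ∈ L.lattice)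
    (hb : b ∉ L.lattice) (hb2 : 2 * b ∈ L.lattice) :
    L.green b ≤ L.green a ↔ ‖L.weierstrassP b‖ ≤ ‖L.weierstrassP a‖ := by
  by_cases hab : a - b ∈ L.lattice
  · rw [← add_sub_cancel b a, L.isPeriodic_green _ hab, L.weierstrassP_add_of_mem hab]
    simp
  -- `a - b` is the third half period; the translation by `-(a - b)` exchanges `a` and `b`
  -- modulo the lattice.
  have hc2 : 2 * (a - b) ∈ L.lattice := by
    rw [mul_sub]; exact L.lattice.sub_mem ha2 hb2
  have hba : b - a ∉ L.lattice := fun h => hab (by simpa using L.lattice.neg_mem h)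
  have hbc : b - (a - b) ∉ L.lattice := fun h => ha (by
    have := L.lattice.sub_mem hb2 h
    rwa [show 2 * b - (b - (a - b)) = a by ring] at this)
  have hac : a - (a - b) ∉ L.lattice := by rwa [sub_sub_cancel]
  obtain ⟨C, hC⟩ := L.exists_log_norm_weierstrassP_sub_eq hab hc2
  have e1 := hC a ha hac
  have e2 := hC b hb hbc
  have hne1 := L.weierstrassP_sub_ne_zero hab hc2 ha hac
  have hne2 := L.weierstrassP_sub_ne_zero hab hc2 hb hbc
  have hne3 := L.weierstrassP_sub_ne_zero ha ha2 hb hba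
  have hg : L.green (b - (a - b)) = L.green a := by
    rw [show b - (a - b) = a + (2 * b - 2 * a) by ring]
    exact L.isPeriodic_green _ (L.lattice.sub_mem hb2 ha2) a
  rw [sub_sub_cancel] at e1
  rw [hg] at e2
  have hroot : ∀ x, x ∉ L.lattice → 2 * x ∈ L.lattice →
      4 * L.weierstrassP x ^ 3 - L.g₂ * L.weierstrassP x - L.g₃ = 0 := fun x hx hx2 => by
    rw [← L.derivWeierstrassP_sq x hx, L.derivWeierstrassP_eq_zero hx2]
    norm_num
  have hsum := add_add_eq_zero_of_cubic (sub_ne_zero.mp hne3).symm (sub_ne_zero.mp hne2)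
    (sub_ne_zero.mp hne1) (hroot a ha ha2) (hroot b hb hb2) (hroot _ hab hc2)
  have hA : L.weierstrassP a - L.weierstrassP (a - b) =
      2 * L.weierstrassP a + L.weierstrassP b := by linear_combination -hsum
  have hB : L.weierstrassP b - L.weierstrassP (a - b) =
      2 * L.weierstrassP b + L.weierstrassP a := by linear_combination -hsum
  rw [← norm_two_mul_add_le_iff, ← hA, ← hB,
    ← Real.log_le_log_iff (norm_pos_iff.mpr hne2) (norm_pos_iff.mpr hne1), e1, e2]
  have := Real.pi_pos
  constructor <;> intro h <;> nlinarith

end PeriodPair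

/-- A flat torus has a Green function `G`, unique away from its pole, and for any two half period
points `G z₀ ≥ G z₁` if and only if `|℘ z₀| ≥ |℘ z₁|`. -/
theorem theorem1p5 (L : PeriodPair) :
    (∃ G : ℂ → ℝ, L.IsGreenFunction G) ∧
    (∀ G G' : ℂ → ℝ, L.IsGreenFunction G → L.IsGreenFunction G' →
      Set.EqOn G G' ((L.lattice : Set ℂ)ᶜ)) ∧
    ∀ G : ℂ → ℝ, L.IsGreenFunction G →
      ∀ z₀ z₁ : ℂ, L.IsHalfPeriodPoint z₀ → L.IsHalfPeriodPoint z₁ →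
        (G z₀ ≥ G z₁ ↔ ‖L.weierstrassP z₀‖ ≥ ‖L.weierstrassP z₁‖) := by
  refine ⟨⟨L.green, L.isGreenFunction_green⟩, fun G G' hG hG' =>
    PeriodPair.IsGreenFunction.eqOn L hG hG', fun G hG z₀ z₁ h₀ h₁ => ?_⟩
  have h := PeriodPair.IsGreenFunction.eqOn L hG L.isGreenFunction_green
  rw [h h₀.notMem_lattice, h h₁.notMem_lattice]
  exact L.green_le_green_iff h₀.notMem_lattice h₀.two_mul_mem_lattice h₁.notMem_lattice
    h₁.two_mul_mem_lattice
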